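/- Let $(D,<)$ be an infinite set with a strict total order that is dense and open (every $d'\in D$ satisfies $d<d'<d''$ for some $d,d''\in D$), and let $V=V_{loc}\uplus V_{rem}$ be a finite set of variables. CLRV$^{XF}(D)$ formulae are given by $$\varphi::=x\approx \mathbf X^iy\mid x<\mathbf X^iy\mid x'\approx \mathbf X^iy'\mid x'\approx \mathbf{XF}y'\mid\varphi\wedge\varphi\mid\neg\varphi\mid \mathbf X\varphi\mid\varphi \mathbf U\varphi\mid \mathbf X^{-1}\varphi\mid\varphi \mathbf S\varphi$$ with $x,y\in V_{loc}$, $x',y'\in V_{rem}$, $i\in\mathbb N$. A model is a sequence $\sigma:\mathbb N\to D^V$; $\sigma,n\models x\approx \mathbf X^iy$ (resp. $x<\mathbf X^iy$) iff $\sigma(n)(x)=\sigma(n+i)(y)$ (resp. $<$); $\sigma,n\models x'\approx \mathbf{XF}y'$ iff $\sigma(n)(x')=\sigma(m)(y')$ for some $m>n$; the other operators are the usual ones of linear-time logic with past; $\varphi$ is satisfiable iff $\sigma,0\models\varphi$ for some model $\sigma$. The local (remote) $\mathbf X$-length $l$ ($r$) of $\varphi$ is the largest $i$ such that a term $\mathbf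 X^ix$ with $x\in V_{loc}$ ($x\in V_{rem}$) occurs in $\varphi$, or $0$ if there is none. Let $\Omega^l$ be the set of constraints $\mathbf X^ix\approx \mathbf X^jy$, $\mathbf X^ix<\mathbf X^jy$ ($i,j\le l$; $x,y\in V_{loc}$), and $\Omega^r$ the set of constraints $\mathbf X^ix\approx \mathbf X^jy$, $\mathbf X^i(x\approx \mathbf{XF}y)$ ($i,j\le r$; $x,y\in V_{rem}$). An $(l,r)$-frame is a set $F\subseteq\Omega^l\cup\Omega^r$ such that * $F\cap\Omega^l$ is the set of all constraints of $\Omega^l$ that hold at position $0$ of some sequence of $D$-valuations of $V_{loc}$; * in $F\cap\Omega^r$ the relation $\approx$ is an equivalence relation on the terms $\mathbf X^ix$; if $\mathbf X^ix\approx \mathbf X^iy\in F$, then $\mathbf X^i(x\approx \mathbf{XF}z)\in F\iff \mathbf X^i(y\approx \mathbf{XF}z)\in F$ for all $z$; and if $\mathbf X^ix\approx \mathbf X^jy\in F$ with $i<j$, then $\mathbf X^i(x\approx \mathbf{XF}y)\in F$ and, for all $z$, $\mathbf X^i(x\approx \mathbf{XF}z)\in F$ iff $\mathbf X^j(y\approx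 \mathbf{XF}z)\in F$ or $\mathbf X^ix\approx \mathbf X^kz\in F$ for some $i<k\le j$. A pair $(F,G)$ of frames is one-step consistent if a constraint all of whose exponents are positive belongs to $F$ iff the constraint with all exponents lowered by one belongs to $G$. A symbolic model is a sequence $\rho$ of $(l,r)$-frames whose consecutive pairs are one-step consistent. $\rho\models_{symb}\varphi$ is defined like satisfaction, except that an atomic formula holds at $n$ iff it belongs to $\rho(n)$. The remote projection of $\rho$ is realizable if there is a sequence $\sigma_r$ of $D$-valuations of $V_{rem}$ with $\rho(n)\cap\Omega^r=\{c\in\Omega^r\mid\sigma_r,n\models c\}$ for all $n$. A simple counter automaton is a finite automaton on infinite words with finitely many counters over $\mathbb N$, initially $0$, to which transitions add integer vectors. Its states are divided into an initial part, which contains the initial states, and finitely many components; a transition stays in its part or leads from the initial part into a component. The only zero tests are of a fixed set $C_i$ of counters on entering component $i$, and transitions inside component $i$ do not change the counters of $C_i$. A run is accepting if it ends up in some component and visits each of the acceptance sets of that component infinitely often (generalized Büchi condition). Over the alphabet of $(l,r)$-frames, let $\mathcal A_{1sc}$ be the Büchi automaton with the frames as states, all of them initial and accepting, and transitions $F\xrightarrow{F}G$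 for one-step consistent pairs $(F,G)$; let $\mathcal A_{symb}$ be the generalized Büchi automaton of Vardi–Wolper type of $\varphi$, read as a linear-time formula with atoms in $\Omega^l\cup\Omega^r$; and let $\mathcal A_{realizable}$ be the simple counter automaton, constructed explicitly below from $V$, $l$, $r$ and the alphabet, with one counter for every non-empty set of remote variables. Let $\mathcal A_\varphi$ be the synchronous product of $\mathcal A_{realizable}$ with $\mathcal A_{1sc}$ and $\mathcal A_{symb}$; it is a simple counter automaton. Then 1. $L(\mathcal A_{1sc})$ is the set of symbolic models; 2. $L(\mathcal A_{symb})$ is the set of sequences $\rho$ of $(l,r)$-frames with $\rho\models_{symb}\varphi$; 3. $L(\mathcal A_{realizable})$ is the set of symbolic models whose remote projection is realizable; 4. $L(\mathcal A_\varphi)=L(\mathcal A_{1sc})\cap L(\mathcal A_{symb})\cap L(\mathcal A_{realizable})$; 5. $\varphi$ is satisfiable if and only if $L(\mathcal A_\varphi)\neq\emptyset$. Construction of $\mathcal A_{realizable}$. For a frame $F$, $i\le r$ and $x\in V_{rem}$ put $N_i(x)=\{y\mid \mathbf X^ix\approx \mathbf X^iy\in F\}$ and $P_i(x)=\{y\mid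 \mathbf X^i(x\approx \mathbf{XF}y)\in F\}$. For $\emptyset\ne Y\subseteq V_{rem}$, $x$ is an end of type $Y$ in $F$ if $\mathbf X^0x\approx \mathbf X^jy\notin F$ for all $y$ and all $0<j\le r$, and $P_0(x)=Y$; $x$ is a start of type $Y$ in $F$ if $\mathbf X^iy\approx \mathbf X^rx\notin F$ for all $y$ and all $i<r$, and $N_r(x)\cup P_r(x)=Y$. Let $\mathrm{inc}_Y(F)$ and $\mathrm{dec}_Y(F)$ be the numbers of distinct sets $N_0(x)$, $x$ an end of type $Y$, and of distinct sets $N_r(x)$, $x$ a start of type $Y$. A cell is a pair $(i,x)$ with $i\le r$, $x\in V_{rem}$; following a cell in $F$ leads from $(i,x)$, $i\ge1$, to $(i-1,x)$, and from $(0,x)$ to each $(j-1,y)$ with $j\ge1$ and $\mathbf X^0x\approx \mathbf X^jy\in F$. A state records the last frame $F$ that was read (none initially), the current part (initial, or a component; the components are the sets $Z$ of counters, and $C_Z=Z$), a set $B_z$ of cells for every $z\in V_{rem}$ (initially empty), and for every $Y$ and $z$ either nothing or one cell $t_{Y,z}$ (initially nothing). On reading a frame $G$: $(F,G)$ has to be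 one-step consistent; every counter $Y$ is changed by $\mathrm{inc}_Y(F)-d_Y$ for any choice of $0\le d_Y\le\mathrm{dec}_Y(G)$, where in component $Z$ both $\mathrm{inc}_Y(F)$ and $d_Y$ have to be $0$ for $Y\in Z$; if $B_z=\emptyset$, the new $B_z$ is the set of all $(i,x)$ with $\mathbf X^i(x\approx \mathbf{XF}z)\in G$, and otherwise the set of cells obtained by following in $F$ the cells $(i,x)\in B_z$ for which no $j>i$ has $\mathbf X^ix\approx \mathbf X^jz\in F$; if $t_{Y,z}$ is nothing, it remains nothing or becomes $(r,x)$ for a start $x$ of type $Y$ in $G$; if $t_{Y,z}=(i,x)$, it becomes a cell to which $(i,x)$ leads in $F$, or it becomes nothing, the latter only if $z\in N_i(x)$ or $P_i(x)\ne Y$ in $F$. (Before the first frame is read, $F=\emptyset$ and there is no consistency condition.) The acceptance sets of component $Z$ are $\{B_z=\emptyset\}$ for every $z$ and, for all $Y\notin Z$ and $z\in Y$, $\{t_{Y,z}\text{ is nothing}\}$ and $\{t_{Y,z}\text{ is a cell}\}$. -/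

import Mathlib

namespace CLRV

/-! ## The logic -/

/-- Formulae of CLRV^XF over the local variables `L` and the remote variables `R`. -/
inductive Formula (L R : Type) : Type
  | locEq (x : L) (i : ℕ) (y : L)
  | locLt (x : L) (i : ℕ) (y : L)
  | remEq (x : R) (i : ℕ) (y : R)
  | remXF (x y : R)
  | conj (a b : Formula L R)
  | neg (a : Formula L R)
  | X (a : Formula L R)
  | U (a b : Formula L R)
  | Xinv (a : Formula L R)
  | S (a b : Formula L R)

namespace Formula

variable {L R : Type}

/-- `Sat σ n φ` is `σ, n ⊨ φ`, for an infinite sequence `σ` of valuations of `L ⊎ R` in `D`. -/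
def Sat {D : Type*} [LT D] (σ : ℕ → L ⊕ R → D) : ℕ → Formula L R → Prop
  | n, locEq x i y => σ n (.inl x) = σ (n + i) (.inl y)
  | n, locLt x i y => σ n (.inl x) < σ (n + i) (.inl y)
  | n, remEq x i y => σ n (.inr x) = σ (n + i) (.inr y)
  | n, remXF x y => ∃ m, n < m ∧ σ n (.inr x) = σ m (.inr y)
  | n, conj a b => Sat σ n a ∧ Sat σ n b
  | n, neg a => ¬ Sat σ n a
  | n, X a => Sat σ (n + 1) a
  | n, U a b => ∃ m, n ≤ m ∧ Sat σ m b ∧ ∀ k, n ≤ k → k < m → Sat σ k a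
  | n, Xinv a => 1 ≤ n ∧ Sat σ (n - 1) a
  | n, S a b => ∃ m, m ≤ n ∧ Sat σ m b ∧ ∀ k, m < k → k ≤ n → Sat σ k a

/-- The formula has a model in which the variables take values in `D`. -/
def Satisfiable (D : Type*) [LT D] (φ : Formula L R) : Prop :=
  ∃ σ : ℕ → L ⊕ R → D, Sat σ 0 φ

/-- The largest `i` such that a term `X^i x` with `x` local occurs (`0` if there is none). -/
def localLength : Formula L R → ℕ
  | locEq _ i _ => i
  | locLt _ i _ => i
  | remEq _ _ _ => 0
  | remXF _ _ => 0
  | conj a b => max a.localLength b.localLength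
  | neg a => a.localLength
  | X a => a.localLength
  | U a b => max a.localLength b.localLength
  | Xinv a => a.localLength
  | S a b => max a.localLength b.localLength

/-- The largest `i` such that a term `X^i x` with `x` remote occurs (`0` if there is none). -/
def remoteLength : Formula L R → ℕ
  | locEq _ _ _ => 0
  | locLt _ _ _ => 0
  | remEq _ i _ => i
  | remXF _ _ => 0
  | conj a b => max a.remoteLength b.remoteLength
  | neg a => a.remoteLength
  | X a => a.remoteLength
  | U a b => max a.remoteLength b.remoteLength
  | Xinv a => a.remoteLength
  | S a b => max a.remoteLength b.remoteLength

/-- The set of subformulae. -/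
def sub : Formula L R → Set (Formula L R)
  | locEq x i y => {locEq x i y}
  | locLt x i y => {locLt x i y}
  | remEq x i y => {remEq x i y}
  | remXF x y => {remXF x y}
  | conj a b => insert (conj a b) (a.sub ∪ b.sub)
  | neg a => insert (neg a) a.sub
  | X a => insert (X a) a.sub
  | U a b => insert (U a b) (a.sub ∪ b.sub)
  | Xinv a => insert (Xinv a) a.sub
  | S a b => insert (S a b) (a.sub ∪ b.sub)

theorem sub_finite (φ : Formula L R) : φ.sub.Finite := by
  induction φ <;> simp_all [sub]

end Formula

/-! ## Constraints and frames -/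

/-- The set `Ω^l`: `eq i x j y` is `X^i x ≈ X^j y` and `lt i x j y` is `X^i x < X^j y`. -/
inductive LocalConstraint (L : Type) (l : ℕ) : Type
  | eq (i : Fin (l + 1)) (x : L) (j : Fin (l + 1)) (y : L)
  | lt (i : Fin (l + 1)) (x : L) (j : Fin (l + 1)) (y : L)

/-- The set `Ω^r`: `eq i x j y` is `X^i x ≈ X^j y` and `xf i x y` is `X^i (x ≈ XF y)`. -/
inductive RemoteConstraint (R : Type) (r : ℕ) : Type
  | eq (i : Fin (r + 1)) (x : R) (j : Fin (r + 1)) (y : R)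
  | xf (i : Fin (r + 1)) (x : R) (y : R)

instance (L : Type) (l : ℕ) [Finite L] : Finite (LocalConstraint L l) := by
  let f : LocalConstraint L l → Bool × Fin (l + 1) × L × Fin (l + 1) × L := fun c =>
    match c with
    | .eq i x j y => (true, i, x, j, y)
    | .lt i x j y => (false, i, x, j, y)
  refine Finite.of_injective f ?_
  intro a b h
  cases a <;> cases b <;> simp_all [f]

instance (R : Type) (r : ℕ) [Finite R] : Finite (RemoteConstraint R r) := by
  let f : RemoteConstraint R r → (Fin (r + 1) × R × Fin (r + 1) × R) ⊕ (Fin (r + 1) × R × R) :=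
    fun c => match c with
    | .eq i x j y => .inl (i, x, j, y)
    | .xf i x y => .inr (i, x, y)
  refine Finite.of_injective f ?_
  intro a b h
  cases a <;> cases b <;> simp_all [f]

/-- `σ, n ⊨ c` for a local model `σ`. -/
def LocalConstraint.Sat {D : Type*} {L : Type} {l : ℕ} [LT D] (σ : ℕ → L → D) (n : ℕ) :
    LocalConstraint L l → Prop
  | eq i x j y => σ (n + i) x = σ (n + j) y
  | lt i x j y => σ (n + i) x < σ (n + j) y

/-- `σ, n ⊨ c` for a remote model `σ`. -/
def RemoteConstraint.Sat {D : Type*} {R : Type} {r : ℕ} (σ : ℕ → R → D) (n : ℕ) :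
    RemoteConstraint R r → Prop
  | eq i x j y => σ (n + i) x = σ (n + j) y
  | xf i x y => ∃ m, n + i < m ∧ σ (n + i) x = σ m y

/-- An `l`-frame with respect to `D`: the set of all constraints of `Ω^l` that hold at the start
of some local model. -/
def IsLocalFrame (D : Type*) [LT D] {L : Type} {l : ℕ} (F : Set (LocalConstraint L l)) : Prop :=
  ∃ σ : ℕ → L → D, F = {c | c.Sat σ 0}

/-- An `r`-frame. -/
structure IsRemoteFrame {R : Type} {r : ℕ} (F : Set (RemoteConstraint R r)) : Prop where
  refl : ∀ i x, .eq i x i x ∈ F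
  symm : ∀ i j x y, .eq i x j y ∈ F ↔ .eq j y i x ∈ F
  trans : ∀ i j k x y z, .eq i x j y ∈ F → .eq j y k z ∈ F → .eq i x k z ∈ F
  xf_same : ∀ i x y, .eq i x i y ∈ F → ∀ z, .xf i x z ∈ F ↔ .xf i y z ∈ F
  xf_mem : ∀ i j x y, i < j → .eq i x j y ∈ F → .xf i x y ∈ F
  xf_iff : ∀ i j x y, i < j → .eq i x j y ∈ F →
    ∀ z, .xf i x z ∈ F ↔ .xf j y z ∈ F ∨ ∃ k, i < k ∧ k ≤ j ∧ .eq i x k z ∈ F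

/-- The set `Ω^l ∪ Ω^r`; the union is disjoint, as `L` and `R` are. -/
abbrev Omega (L R : Type) (l r : ℕ) : Type := LocalConstraint L l ⊕ RemoteConstraint R r

/-- The local projection `FR ∩ Ω^l`. -/
def localProj {L R : Type} {l r : ℕ} (FR : Set (Omega L R l r)) : Set (LocalConstraint L l) :=
  {c | Sum.inl c ∈ FR}

/-- The remote projection `FR ∩ Ω^r`. -/
def remoteProj {L R : Type} {l r : ℕ} (FR : Set (Omega L R l r)) : Set (RemoteConstraint R r) :=
  {c | Sum.inr c ∈ FR}

/-- The set of all `(l, r)`-frames with respect to `D`. -/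
def Frame (D : Type*) [LT D] (L R : Type) (l r : ℕ) : Type :=
  {FR : Set (Omega L R l r) // IsLocalFrame D (localProj FR) ∧ IsRemoteFrame (remoteProj FR)}

instance (D : Type*) [LT D] (L R : Type) (l r : ℕ) [Finite L] [Finite R] :
    Finite (Frame D L R l r) := by
  unfold Frame; infer_instance

/-- One-step consistency of a pair of sets of local constraints. -/
structure LocalOneStep {L : Type} {l : ℕ} (F G : Set (LocalConstraint L l)) : Prop where
  eq_iff : ∀ (i j : Fin l) x y, .eq i.succ x j.succ y ∈ F ↔ .eq i.castSucc x j.castSucc y ∈ G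
  lt_iff : ∀ (i j : Fin l) x y, .lt i.succ x j.succ y ∈ F ↔ .lt i.castSucc x j.castSucc y ∈ G

/-- One-step consistency of a pair of sets of remote constraints. -/
structure RemoteOneStep {R : Type} {r : ℕ} (F G : Set (RemoteConstraint R r)) : Prop where
  eq_iff : ∀ (i j : Fin r) x y, .eq i.succ x j.succ y ∈ F ↔ .eq i.castSucc x j.castSucc y ∈ G
  xf_iff : ∀ (i : Fin r) x y, .xf i.succ x y ∈ F ↔ .xf i.castSucc x y ∈ G

section Symbolic

variable {D : Type*} [LT D] {L R : Type} {l r : ℕ}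

/-- One-step consistency of a pair of `(l, r)`-frames. -/
def OneStep (F G : Frame D L R l r) : Prop :=
  LocalOneStep (localProj F.1) (localProj G.1) ∧ RemoteOneStep (remoteProj F.1) (remoteProj G.1)

/-- A sequence of `(l, r)`-frames is a symbolic model. -/
def IsSymbolicModel (ρ : ℕ → Frame D L R l r) : Prop := ∀ n, OneStep (ρ n) (ρ (n + 1))

/-- The remote projection of `ρ` admits a remote model. -/
def RemoteRealizable (ρ : ℕ → Frame D L R l r) : Prop :=
  ∃ σ : ℕ → R → D, ∀ n, remoteProj (ρ n).1 = {c | c.Sat σ n}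

/-- The atomic formula `ψ` is the constraint `c` of `Ω^l ∪ Ω^r`. -/
def Formula.IsConstraint : Formula L R → Omega L R l r → Prop
  | .locEq x i y, c => ∃ j : Fin (l + 1), (j : ℕ) = i ∧ c = .inl (.eq 0 x j y)
  | .locLt x i y, c => ∃ j : Fin (l + 1), (j : ℕ) = i ∧ c = .inl (.lt 0 x j y)
  | .remEq x i y, c => ∃ j : Fin (r + 1), (j : ℕ) = i ∧ c = .inr (.eq 0 x j y)
  | .remXF x y, c => c = .inr (.xf 0 x y)
  | _, _ => False

/-- An atomic formula belongs to a frame. -/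
def Formula.AtomMem (ψ : Formula L R) (FR : Frame D L R l r) : Prop :=
  ∃ c ∈ FR.1, ψ.IsConstraint c

/-- `SymbSat ρ n φ` is `ρ, n ⊨_symb φ`. -/
def SymbSat (ρ : ℕ → Frame D L R l r) : ℕ → Formula L R → Prop
  | n, .locEq x i y => (Formula.locEq x i y).AtomMem (ρ n)
  | n, .locLt x i y => (Formula.locLt x i y).AtomMem (ρ n)
  | n, .remEq x i y => (Formula.remEq x i y).AtomMem (ρ n)
  | n, .remXF x y => (Formula.remXF x y).AtomMem (ρ n)
  | n, .conj a b => SymbSat ρ n a ∧ SymbSat ρ n b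
  | n, .neg a => ¬ SymbSat ρ n a
  | n, .X a => SymbSat ρ (n + 1) a
  | n, .U a b => ∃ m, n ≤ m ∧ SymbSat ρ m b ∧ ∀ k, n ≤ k → k < m → SymbSat ρ k a
  | n, .Xinv a => 1 ≤ n ∧ SymbSat ρ (n - 1) a
  | n, .S a b => ∃ m, m ≤ n ∧ SymbSat ρ m b ∧ ∀ k, m < k → k ≤ n → SymbSat ρ k a

end Symbolic

/-! ## Automata on infinite words -/

/-- A (generalized) Büchi automaton over the alphabet `A`: a run is accepting if it visits every
set of the family `acc` infinitely often. -/
structure BuchiAutomaton (A : Type) where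
  State : Type
  finite_state : Finite State
  init : Set State
  trans : State → A → State → Prop
  acc : Set (Set State)

/-- The language of a Büchi automaton. -/
def BuchiAutomaton.language {A : Type} (B : BuchiAutomaton A) : Set (ℕ → A) :=
  {w | ∃ q : ℕ → B.State, q 0 ∈ B.init ∧ (∀ n, B.trans (q n) (w n) (q (n + 1))) ∧
    ∀ F ∈ B.acc, ∀ N, ∃ n, N ≤ n ∧ q n ∈ F}

/-- A simple counter automaton over the alphabet `A`. Its states are divided into an initial part
(`comp q = none`) and finitely many components (`comp q = some i`). A transition stays within its
part or leads from the initial part into a component. The only zero tests happen on entering a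
component `i`: the counters in `tested i` must then be zero, and inside the component they are not
changed any more. Every component carries a generalized Büchi condition. -/
structure SimpleCounterAutomaton (A : Type) where
  State : Type
  finite_state : Finite State
  Counter : Type
  finite_counter : Finite Counter
  Component : Type
  finite_component : Finite Component
  comp : State → Option Component
  tested : Component → Set Counter
  init : Set State
  trans : Set (State × A × (Counter → ℤ) × State)
  acc : Component → Set (Set State)
  trans_finite : trans.Finite
  comp_init : ∀ q ∈ init, comp q = none
  comp_trans : ∀ q a u p, (q, a, u, p) ∈ trans → comp q = none ∨ comp p = comp q
  tested_frozen : ∀ q a u p, (q, a, u, p) ∈ trans → ∀ i, comp q = some i →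
    ∀ c ∈ tested i, u c = 0

/-- `q` (states), `v` (counter values), `u` (updates) form a run on the word `w`. -/
structure SimpleCounterAutomaton.IsRun {A : Type} (M : SimpleCounterAutomaton A) (w : ℕ → A)
    (q : ℕ → M.State) (v : ℕ → M.Counter → ℕ) (u : ℕ → M.Counter → ℤ) : Prop where
  init : q 0 ∈ M.init
  zero : ∀ c, v 0 c = 0
  trans : ∀ n, (q n, w n, u n, q (n + 1)) ∈ M.trans
  update : ∀ n c, (v (n + 1) c : ℤ) = v n c + u n c
  zero_test : ∀ n i, M.comp (q n) = none → M.comp (q (n + 1)) = some i →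
    ∀ c ∈ M.tested i, v (n + 1) c = 0

/-- The language of a simple counter automaton: the words with a run that ends up in some
component and visits every acceptance set of this component infinitely often. -/
def SimpleCounterAutomaton.language {A : Type} (M : SimpleCounterAutomaton A) : Set (ℕ → A) :=
  {w | ∃ q v u, M.IsRun w q v u ∧ ∃ i, (∃ N, ∀ n, N ≤ n → M.comp (q n) = some i) ∧
    ∀ F ∈ M.acc i, ∀ N, ∃ n, N ≤ n ∧ q n ∈ F}

/-- The synchronous product of a simple counter automaton with a Büchi automaton. -/
def SimpleCounterAutomaton.prod {A : Type} (M : SimpleCounterAutomaton A) (B : BuchiAutomaton A) :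
    SimpleCounterAutomaton A where
  State := M.State × B.State
  finite_state := by
    have := M.finite_state
    have := B.finite_state
    infer_instance
  Counter := M.Counter
  finite_counter := M.finite_counter
  Component := M.Component
  finite_component := M.finite_component
  comp := fun q => M.comp q.1
  tested := M.tested
  init := {q | q.1 ∈ M.init ∧ q.2 ∈ B.init}
  trans := {t | (t.1.1, t.2.1, t.2.2.1, t.2.2.2.1) ∈ M.trans ∧ B.trans t.1.2 t.2.1 t.2.2.2.2}
  acc := fun i => {F | ∃ G ∈ M.acc i, F = {q | q.1 ∈ G}} ∪ {F | ∃ G ∈ B.acc, F = {q | q.2 ∈ G}}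
  trans_finite := by
    have := B.finite_state
    let f : ((M.State × B.State) × A × (M.Counter → ℤ) × (M.State × B.State)) →
        (M.State × A × (M.Counter → ℤ) × M.State) × (B.State × B.State) :=
      fun t => ((t.1.1, t.2.1, t.2.2.1, t.2.2.2.1), (t.1.2, t.2.2.2.2))
    have hf : Function.Injective f := by
      rintro ⟨⟨a, b⟩, c, d, e, g⟩ ⟨⟨a2, b2⟩, c2, d2, e2, g2⟩ h
      simp only [f, Prod.mk.injEq] at h
      simp only [Prod.mk.injEq]
      tauto
    have h1 : (M.trans ×ˢ (Set.univ : Set (B.State × B.State))).Finite :=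
      M.trans_finite.prod Set.finite_univ
    refine (h1.preimage (f := f) hf.injOn).subset ?_
    intro t ht
    exact ⟨ht.1, Set.mem_univ _⟩
  comp_init := fun q hq => M.comp_init q.1 hq.1
  comp_trans := fun _ _ _ _ h => M.comp_trans _ _ _ _ h.1
  tested_frozen := fun _ _ _ _ h => M.tested_frozen _ _ _ _ h.1

/-! ## The automaton for one-step consistency -/

/-- The automaton `A_1sc`. -/
def oneStepAutomaton (D : Type*) [LT D] (L R : Type) [Finite L] [Finite R] (l r : ℕ) :
    BuchiAutomaton (Frame D L R l r) where
  State := Frame D L R l r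
  finite_state := inferInstance
  init := Set.univ
  trans := fun F G H => G = F ∧ OneStep F H
  acc := {Set.univ}

/-! ## The Vardi-Wolper automaton -/

section VardiWolper

variable {D : Type*} [LT D] {L R : Type} {l r : ℕ}

/-- Initial states of the Vardi-Wolper automaton. -/
structure VWInit (φ : Formula L R) (q : Set (Formula L R)) : Prop where
  mem : φ ∈ q
  prev : ∀ a, .Xinv a ∉ q
  since : ∀ a b, .S a b ∈ φ.sub → (.S a b ∈ q ↔ b ∈ q)

/-- Transitions of the Vardi-Wolper automaton from `q` to `p`, reading `FR`. A state is the set of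
subformulae of `φ` that are guessed to hold at the current position. -/
structure VWStep (φ : Formula L R) (q : Set (Formula L R)) (FR : Frame D L R l r)
    (p : Set (Formula L R)) : Prop where
  locEq : ∀ x i y, .locEq x i y ∈ φ.sub →
    (.locEq x i y ∈ q ↔ (Formula.locEq x i y).AtomMem FR)
  locLt : ∀ x i y, .locLt x i y ∈ φ.sub →
    (.locLt x i y ∈ q ↔ (Formula.locLt x i y).AtomMem FR)
  remEq : ∀ x i y, .remEq x i y ∈ φ.sub →
    (.remEq x i y ∈ q ↔ (Formula.remEq x i y).AtomMem FR)
  remXF : ∀ x y, .remXF x y ∈ φ.sub →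
    (.remXF x y ∈ q ↔ (Formula.remXF x y).AtomMem FR)
  conj : ∀ a b, .conj a b ∈ φ.sub → (.conj a b ∈ q ↔ a ∈ q ∧ b ∈ q)
  neg : ∀ a, .neg a ∈ φ.sub → (.neg a ∈ q ↔ a ∉ q)
  next : ∀ a, .X a ∈ φ.sub → (.X a ∈ q ↔ a ∈ p)
  untl : ∀ a b, .U a b ∈ φ.sub → (.U a b ∈ q ↔ b ∈ q ∨ (a ∈ q ∧ .U a b ∈ p))
  prev : ∀ a, .Xinv a ∈ φ.sub → (.Xinv a ∈ p ↔ a ∈ q)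
  since : ∀ a b, .S a b ∈ φ.sub → (.S a b ∈ p ↔ b ∈ p ∨ (a ∈ p ∧ .S a b ∈ q))

variable (D l r) in
/-- The automaton `A_symb`: the Vardi-Wolper automaton of `φ`, read as a linear-time formula over
the atoms `Ω^l ∪ Ω^r`, with one acceptance set for every eventuality. -/
def symbAutomaton (φ : Formula L R) : BuchiAutomaton (Frame D L R l r) where
  State := {q : Set (Formula L R) // q ⊆ φ.sub}
  finite_state := φ.sub_finite.finite_subsets.to_subtype
  init := {q | VWInit φ q.1}
  trans := fun q FR p => VWStep φ q.1 FR p.1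
  acc := {F | ∃ a b, .U a b ∈ φ.sub ∧ F = {q | b ∈ q.1 ∨ .U a b ∉ q.1}}

end VardiWolper

/-! ## The automaton for realizability of the remote projection

A *thread* of a symbolic model is a class of occurrences `(position, variable)` connected by the
equalities of the frames; consecutive positions of a thread are at most `r` apart. A value of a
remote model is a chain of threads. For every non-empty set `Y` of remote variables a counter
holds the number of values whose last thread is over and which still have to occur later, in
exactly the variables of `Y`. -/

section Real

variable {R : Type} {r : ℕ}

/-- The variables that are equal to `x` at level `i` of the frame. -/
def nowSet (F : Set (RemoteConstraint R r)) (i : Fin (r + 1)) (x : R) : Set R :=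
  {y | .eq i x i y ∈ F}

/-- The variables in which the value of `x` at level `i` is to be repeated later. -/
def xfSet (F : Set (RemoteConstraint R r)) (i : Fin (r + 1)) (x : R) : Set R :=
  {y | .xf i x y ∈ F}

/-- The points of increment for `Y`: the classes at level `0` that are not continued in the frame
and whose value is to be repeated exactly in `Y`. -/
def incPoints (F : Set (RemoteConstraint R r)) (Y : Set R) : Set (Set R) :=
  {C | ∃ x, C = nowSet F 0 x ∧ (∀ j y, 0 < j → .eq 0 x j y ∉ F) ∧ xfSet F 0 x = Y}

/-- The class of `x` at level `r` has no predecessor in the frame, and its value occurs now or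
later exactly in the variables of `Y`. -/
def IsStart (F : Set (RemoteConstraint R r)) (Y : Set R) (x : R) : Prop :=
  (∀ i y, i < Fin.last r → .eq i y (Fin.last r) x ∉ F) ∧
    nowSet F (Fin.last r) x ∪ xfSet F (Fin.last r) x = Y

/-- The points of decrement for `Y`. -/
def decPoints (F : Set (RemoteConstraint R r)) (Y : Set R) : Set (Set R) :=
  {C | ∃ x, C = nowSet F (Fin.last r) x ∧ IsStart F Y x}

/-- A cell: a level and a variable, to be read in a given frame. -/
abbrev Cell (R : Type) (r : ℕ) : Type := Fin (r + 1) × R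

/-- Following a thread from the cell `c` of the frame `F` to the cell `d` of the next frame. -/
def Follow (F : Set (RemoteConstraint R r)) (c d : Cell R r) : Prop :=
  ((c.1 : ℕ) = d.1 + 1 ∧ c.2 = d.2) ∨
    (c.1 = 0 ∧ ∃ j : Fin (r + 1), (j : ℕ) = d.1 + 1 ∧ .eq 0 c.2 j d.2 ∈ F)

/-- The counters: non-empty sets of remote variables. -/
abbrev RCounter (R : Type) : Type := {Y : Set R // Y.Nonempty}

/-- States of the realizability automaton: the frame read last; the component (`none` is the
initial part, `some Z` the component in which the counters of `Z` have been tested); for every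
`z`, cells of `last` whose threads still have to be seen to reach `z` or to end; for every `Y` and
`z`, possibly a cell of `last`, in a thread of start type `Y` that is being followed. -/
structure RealState (D : Type*) [LT D] (L R : Type) (l r : ℕ) : Type where
  last : Option (Frame D L R l r)
  comp : Option (Set (RCounter R))
  pend : R → Set (Cell R r)
  track : RCounter R → R → Option (Cell R r)

instance (D : Type*) [LT D] (L R : Type) (l r : ℕ) [Finite L] [Finite R] :
    Finite (RealState D L R l r) := by
  let f : RealState D L R l r → Option (Frame D L R l r) × Option (Set (RCounter R)) ×
      (R → Set (Cell R r)) × (RCounter R → R → Option (Cell R r)) :=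
    fun s => (s.last, s.comp, s.pend, s.track)
  refine Finite.of_injective f ?_
  rintro ⟨⟩ ⟨⟩ h
  simpa [f] using h

end Real

section RealAutomaton

variable {D : Type*} [LT D] {L R : Type} {l r : ℕ}

/-- The remote projection of the frame read last (empty at the start). -/
def RealState.rem (s : RealState D L R l r) : Set (RemoteConstraint R r) :=
  {c | ∃ F, s.last = some F ∧ c ∈ remoteProj F.1}

/-- Transitions of the realizability automaton. A point of increment of a frame takes effect when
the next frame is read, so that a value is never continued within the frame in which its thread
ends; a point of decrement may be used to continue a waiting value or not. -/
structure RealStep (s : RealState D L R l r) (FR : Frame D L R l r) (u : RCounter R → ℤ)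
    (t : RealState D L R l r) : Prop where
  last : t.last = some FR
  oneStep : ∀ F, s.last = some F → OneStep F FR
  comp : s.comp = none ∨ t.comp = s.comp
  count : ∃ d : RCounter R → ℕ, (∀ Y, d Y ≤ (decPoints (remoteProj FR.1) Y.1).ncard) ∧
    (∀ Y, u Y = ((incPoints s.rem Y.1).ncard : ℤ) - d Y) ∧
    ∀ Z, s.comp = some Z → ∀ Y ∈ Z, (incPoints s.rem Y.1).ncard = 0 ∧ d Y = 0
  pend_reload : ∀ z, s.pend z = ∅ → t.pend z = {c | .xf c.1 c.2 z ∈ remoteProj FR.1}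
  pend_follow : ∀ z, s.pend z ≠ ∅ →
    t.pend z = {d | ∃ c ∈ s.pend z, (∀ j, c.1 < j → .eq c.1 c.2 j z ∉ s.rem) ∧ Follow s.rem c d}
  track_none : ∀ Y z, s.track Y z = none → t.track Y z = none ∨
    ∃ x, IsStart (remoteProj FR.1) Y.1 x ∧ t.track Y z = some (Fin.last r, x)
  track_some : ∀ Y z c, s.track Y z = some c →
    ((z ∈ nowSet s.rem c.1 c.2 ∨ xfSet s.rem c.1 c.2 ≠ Y.1) ∧ t.track Y z = none) ∨
    ∃ d, Follow s.rem c d ∧ t.track Y z = some d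

variable (D L R l r) in
/-- The simple counter automaton `A_realizable`. -/
def realAutomaton [Finite L] [Finite R] : SimpleCounterAutomaton (Frame D L R l r) where
  State := RealState D L R l r
  finite_state := inferInstance
  Counter := RCounter R
  finite_counter := inferInstance
  Component := Set (RCounter R)
  finite_component := inferInstance
  comp := RealState.comp
  tested := fun Z => Z
  init := {s | s.last = none ∧ s.comp = none ∧ (∀ z, s.pend z = ∅) ∧ ∀ Y z, s.track Y z = none}
  trans := {x | RealStep x.1 x.2.1 x.2.2.1 x.2.2.2}
  acc := fun Z => {F | ∃ z, F = {s | s.pend z = ∅}} ∪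
    {F | ∃ Y ∉ Z, ∃ z ∈ Y.1, F = {s | s.track Y z = none} ∨ F = {s | s.track Y z ≠ none}}
  trans_finite := by
    obtain ⟨b, hb⟩ : ∃ b : ℤ, ∀ T : Set (Set R), (T.ncard : ℤ) ≤ b :=
      ⟨(Nat.card (Set R) : ℤ), fun T => by exact_mod_cast Set.ncard_le_card T⟩
    have h1 : (Set.univ.pi fun _ : RCounter R => Set.Icc (-b) b).Finite :=
      Set.Finite.pi fun _ => Set.finite_Icc _ _
    have h2 := (Set.finite_univ (α := RealState D L R l r)).prod
      ((Set.finite_univ (α := Frame D L R l r)).prod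
        (h1.prod (Set.finite_univ (α := RealState D L R l r))))
    refine h2.subset ?_
    rintro ⟨s, FR, u, t⟩ h
    obtain ⟨d, hd, hu, -⟩ := RealStep.count h
    refine ⟨Set.mem_univ _, Set.mem_univ _, ?_, Set.mem_univ _⟩
    intro Y _
    have e1 := hb (incPoints s.rem Y.1)
    have e2 := hb (decPoints (remoteProj FR.1) Y.1)
    have e3 : (d Y : ℤ) ≤ ((decPoints (remoteProj FR.1) Y.1).ncard : ℤ) := by
      exact_mod_cast hd Y
    have e4 := hu Y
    dsimp only at e4 ⊢
    constructor <;> omega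
  comp_init := fun _ h => h.2.1
  comp_trans := fun _ _ _ _ h => RealStep.comp h
  tested_frozen := by
    intro s FR u t h Z hZ Y hY
    obtain ⟨d, -, hu, h0⟩ := RealStep.count h
    have e1 := h0 Z hZ Y hY
    have e2 := hu Y
    dsimp only at e1 e2
    omega

end RealAutomaton

/-- The simple counter automaton `A_φ`, the product of `A_realizable`, `A_1sc` and `A_symb` over
the alphabet of `(l, r)`-frames, where `l` and `r` are the local and remote lengths of `φ`. -/
def formulaAutomaton (D : Type*) [LT D] {L R : Type} [Finite L] [Finite R] (φ : Formula L R) :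
    SimpleCounterAutomaton (Frame D L R φ.localLength φ.remoteLength) :=
  ((realAutomaton D L R φ.localLength φ.remoteLength).prod
    (oneStepAutomaton D L R φ.localLength φ.remoteLength)).prod
    (symbAutomaton D φ.localLength φ.remoteLength φ)

end CLRV

namespace CLRV

/-! ## The automaton for one-step consistency -/

/-! The languages of `A_1sc`, `A_symb` and of products are found by standard arguments. For the last
claim, a satisfying symbolic model has to be realized. Its local projection always can be: in a
dense open order, a finite configuration extends by one more point of prescribed relative position,
so valuations are built one position at a time (`exists_local_realization`). The core is the remote
projection.

Frames decide equalities only between positions at most `r` apart. Following each class to the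
nearest later class linked with it splits the occurrences into threads, and a realization has to say
which threads share a value. A thread that ends with a non-empty set `Y` of due variables must be
continued by a thread that starts more than `r` positions later and whose value occurs, now or
later, exactly in `Y`. If the continuation is injective, the resulting chains are disjoint. Giving
distinct chains distinct values is then correct as soon as every due variable is eventually met
(`exists_realization`). Due sets only shrink along a chain, so a variable `z` that is missed forever
is due with an eventually constant set `Y`. Either the chain finally stays in one infinite thread,
which is excluded because `B_z` is empty infinitely often, or it passes infinitely many ends of type
`Y`, which is excluded by the fairness of the continuation (`IsContinuation`).

An accepting run supplies the continuations. For a tested counter, the value zero leaves enough late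
starts for all earlier ends, and Hall's theorem matches them (`exists_isContinuation_of_count`). For
an untested counter, the tracked cells show that, for each `z` in `Y`, infinitely many starts of
type `Y` lie on threads that meet `z` or lose the due set `Y`. These are distributed so that every
chain with infinitely many ends of type `Y` gets one for each `z` (`exists_isContinuation_of_good`).

Conversely, a realization yields an accepting run: counters count the values that are waiting, the
tested set consists of the counters incremented only finitely often, and the excursions to be
tracked are read off from values that wait infinitely often (`mem_language_of_remoteRealizable`). -/

theorem oneStepAutomaton_language (D : Type*) [LT D] (L R : Type) [Finite L] [Finite R] (l r : ℕ) :
    (oneStepAutomaton D L R l r).language = {ρ | IsSymbolicModel ρ} := by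
  ext ρ
  constructor
  · rintro ⟨q, -, h, -⟩ n
    have h1 : ρ n = q n := (h n).1
    have h2 : ρ (n + 1) = q (n + 1) := (h (n + 1)).1
    rw [h1, h2]
    exact (h n).2
  · intro h
    refine ⟨ρ, Set.mem_univ _, fun n => ⟨rfl, h n⟩, ?_⟩
    rintro F rfl N
    exact ⟨N, le_rfl, Set.mem_univ _⟩

/-! ## Products -/

theorem SimpleCounterAutomaton.prod_language {A : Type} (M : SimpleCounterAutomaton A)
    (B : BuchiAutomaton A) : (M.prod B).language = M.language ∩ B.language := by
  ext w
  constructor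
  · rintro ⟨q, v, u, hr, i, hN, hacc⟩
    refine ⟨⟨fun n => (q n).1, v, u, ⟨hr.init.1, hr.zero, fun n => (hr.trans n).1, hr.update,
      hr.zero_test⟩, i, hN, fun F hF N => ?_⟩, fun n => (q n).2, hr.init.2,
      fun n => (hr.trans n).2, fun F hF N => ?_⟩
    · exact hacc _ (Or.inl ⟨F, hF, rfl⟩) N
    · exact hacc _ (Or.inr ⟨F, hF, rfl⟩) N
  · rintro ⟨⟨q, v, u, hr, i, hN, hacc⟩, p, hp, ht, hB⟩
    refine ⟨fun n => (q n, p n), v, u, ⟨⟨hr.init, hp⟩, hr.zero, fun n => ⟨hr.trans n, ht n⟩,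
      hr.update, hr.zero_test⟩, i, hN, ?_⟩
    rintro F (⟨G, hG, rfl⟩ | ⟨G, hG, rfl⟩) N
    · exact hacc G hG N
    · exact hB G hG N

/-! ## The Vardi-Wolper automaton -/

section VardiWolper

variable {D : Type*} [LT D] {L R : Type} {l r : ℕ}

theorem Formula.mem_sub_self (φ : Formula L R) : φ ∈ φ.sub := by
  cases φ <;> simp [Formula.sub]

theorem Formula.sub_subset_of_mem {φ ψ : Formula L R} (h : ψ ∈ φ.sub) : ψ.sub ⊆ φ.sub := by
  induction φ with
  | locEq | locLt | remEq | remXF =>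
    simp only [Formula.sub, Set.mem_singleton_iff] at h
    subst h; exact subset_rfl
  | conj a b iha ihb | U a b iha ihb | S a b iha ihb =>
    simp only [Formula.sub, Set.mem_insert_iff, Set.mem_union] at h
    rcases h with rfl | h | h
    · exact subset_rfl
    · exact (iha h).trans (Set.subset_union_left.trans (Set.subset_insert _ _))
    · exact (ihb h).trans (Set.subset_union_right.trans (Set.subset_insert _ _))
  | neg a iha | X a iha | Xinv a iha =>
    simp only [Formula.sub, Set.mem_insert_iff] at h
    rcases h with rfl | h
    · exact subset_rfl
    · exact (iha h).trans (Set.subset_insert _ _)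

theorem symbSat_U_iff (ρ : ℕ → Frame D L R l r) (n : ℕ) (a b : Formula L R) :
    SymbSat ρ n (.U a b) ↔ SymbSat ρ n b ∨ (SymbSat ρ n a ∧ SymbSat ρ (n + 1) (.U a b)) := by
  simp only [SymbSat]
  constructor
  · rintro ⟨m, hm, hb, ha⟩
    rcases hm.eq_or_lt with rfl | hlt
    · exact Or.inl hb
    · exact Or.inr ⟨ha n le_rfl hlt, m, hlt, hb, fun k hk => ha k (by omega)⟩
  · rintro (hb | ⟨ha, m, hm, hb, h⟩)
    · exact ⟨n, le_rfl, hb, fun k h1 h2 => by omega⟩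
    · refine ⟨m, by omega, hb, fun k h1 h2 => ?_⟩
      rcases h1.eq_or_lt with rfl | hlt
      · exact ha
      · exact h k hlt h2

theorem symbSat_S_zero (ρ : ℕ → Frame D L R l r) (a b : Formula L R) :
    SymbSat ρ 0 (.S a b) ↔ SymbSat ρ 0 b := by
  simp only [SymbSat]
  constructor
  · rintro ⟨m, hm, hb, -⟩
    obtain rfl : m = 0 := by omega
    exact hb
  · exact fun hb => ⟨0, le_rfl, hb, fun k h1 h2 => by omega⟩

theorem symbSat_S_succ (ρ : ℕ → Frame D L R l r) (n : ℕ) (a b : Formula L R) :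
    SymbSat ρ (n + 1) (.S a b) ↔
      SymbSat ρ (n + 1) b ∨ (SymbSat ρ (n + 1) a ∧ SymbSat ρ n (.S a b)) := by
  simp only [SymbSat]
  constructor
  · rintro ⟨m, hm, hb, ha⟩
    rcases hm.eq_or_lt with rfl | hlt
    · exact Or.inl hb
    · exact Or.inr ⟨ha _ hlt le_rfl, m, by omega, hb, fun k h1 h2 => ha k h1 (by omega)⟩
  · rintro (hb | ⟨ha, m, hm, hb, h⟩)
    · exact ⟨n + 1, le_rfl, hb, fun k h1 h2 => by omega⟩
    · refine ⟨m, by omega, hb, fun k h1 h2 => ?_⟩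
      rcases h2.eq_or_lt with rfl | hlt
      · exact ha
      · exact h k h1 (by omega)

theorem mem_run_iff_symbSat {φ : Formula L R} {ρ : ℕ → Frame D L R l r} {q : ℕ → Set (Formula L R)}
    (h0 : VWInit φ (q 0)) (ht : ∀ n, VWStep φ (q n) (ρ n) (q (n + 1)))
    (hacc : ∀ a b, .U a b ∈ φ.sub → ∀ N, ∃ n, N ≤ n ∧ (b ∈ q n ∨ .U a b ∉ q n))
    (ψ : Formula L R) (hψ : ψ ∈ φ.sub) (n : ℕ) : ψ ∈ q n ↔ SymbSat ρ n ψ := by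
  induction ψ generalizing n with
  | locEq x i y => exact (ht n).locEq x i y hψ
  | locLt x i y => exact (ht n).locLt x i y hψ
  | remEq x i y => exact (ht n).remEq x i y hψ
  | remXF x y => exact (ht n).remXF x y hψ
  | conj a b iha ihb =>
    have hs := Formula.sub_subset_of_mem hψ
    have ha : a ∈ φ.sub := hs (by simp [Formula.sub, a.mem_sub_self])
    have hb : b ∈ φ.sub := hs (by simp [Formula.sub, b.mem_sub_self])
    rw [(ht n).conj a b hψ, iha ha, ihb hb]; rfl
  | neg a iha =>
    have ha : a ∈ φ.sub :=
      Formula.sub_subset_of_mem hψ (by simp [Formula.sub, a.mem_sub_self])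
    rw [(ht n).neg a hψ, iha ha]; rfl
  | X a iha =>
    have ha : a ∈ φ.sub :=
      Formula.sub_subset_of_mem hψ (by simp [Formula.sub, a.mem_sub_self])
    rw [(ht n).next a hψ, iha ha]; rfl
  | U a b iha ihb =>
    have hs := Formula.sub_subset_of_mem hψ
    have ha : a ∈ φ.sub := hs (by simp [Formula.sub, a.mem_sub_self])
    have hb : b ∈ φ.sub := hs (by simp [Formula.sub, b.mem_sub_self])
    have hstep := fun n => (ht n).untl a b hψ
    constructor
    · intro hU
      -- Induction on the distance to the next accepting visit: an until that is still unfulfilled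
      -- there belongs to the state, so the visit must be due to `b`.
      obtain ⟨m, hm, hm'⟩ := hacc a b hψ n
      obtain ⟨d, rfl⟩ := Nat.exists_eq_add_of_le hm
      clear hm
      induction d generalizing n with
      | zero =>
        rw [symbSat_U_iff, ← ihb hb]
        exact Or.inl (hm'.resolve_right (fun h => h hU))
      | succ d ihd =>
        rw [symbSat_U_iff, ← ihb hb, ← iha ha]
        refine ((hstep n).1 hU).imp_right fun h => ⟨h.1, ihd (n + 1) h.2 ?_⟩
        rwa [show n + 1 + d = n + (d + 1) by omega]
    · rintro ⟨m, hm, hbm, ham⟩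
      obtain ⟨d, rfl⟩ := Nat.exists_eq_add_of_le hm
      clear hm
      induction d generalizing n with
      | zero => exact (hstep n).2 (Or.inl ((ihb hb n).2 hbm))
      | succ d ihd =>
        refine (hstep n).2 (Or.inr ⟨(iha ha n).2 (ham n le_rfl (by omega)), ihd (n + 1) ?_ ?_⟩)
        · rwa [show n + 1 + d = n + (d + 1) by omega]
        · exact fun k h1 h2 => ham k (by omega) (by omega)
  | Xinv a iha =>
    have ha : a ∈ φ.sub :=
      Formula.sub_subset_of_mem hψ (by simp [Formula.sub, a.mem_sub_self])
    cases n with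
    | zero => simpa [SymbSat] using h0.prev a
    | succ n => rw [(ht n).prev a hψ, iha ha]; simp [SymbSat]
  | S a b iha ihb =>
    have hs := Formula.sub_subset_of_mem hψ
    have ha : a ∈ φ.sub := hs (by simp [Formula.sub, a.mem_sub_self])
    have hb : b ∈ φ.sub := hs (by simp [Formula.sub, b.mem_sub_self])
    induction n with
    | zero => rw [h0.since a b hψ, ihb hb, symbSat_S_zero]
    | succ n ih =>
      rw [(ht n).since a b hψ, ihb hb, iha ha, symbSat_S_succ]
      exact or_congr_right (and_congr_right fun _ => ih)

theorem symbAutomaton_language (φ : Formula L R) :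
    (symbAutomaton D l r φ).language = {ρ | SymbSat ρ 0 φ} := by
  ext ρ
  constructor
  · rintro ⟨q, h0, ht, hacc⟩
    refine (mem_run_iff_symbSat (q := fun n => (q n).1) h0 ht ?_ φ φ.mem_sub_self 0).1 h0.mem
    exact fun a b h N => hacc _ ⟨a, b, h, rfl⟩ N
  · intro h
    have hsub : ∀ {ψ χ : Formula L R}, ψ ∈ φ.sub → χ ∈ ψ.sub → χ ∈ φ.sub :=
      fun h1 h2 => Formula.sub_subset_of_mem h1 h2
    have self := fun ψ : Formula L R => ψ.mem_sub_self
    refine ⟨fun n => ⟨{ψ | ψ ∈ φ.sub ∧ SymbSat ρ n ψ}, fun _ h => h.1⟩,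
      ⟨⟨φ.mem_sub_self, h⟩, ?_, ?_⟩, fun n => ?_, ?_⟩
    · rintro a ⟨-, h, -⟩
      omega
    · intro a b hab
      have hb : b ∈ φ.sub := hsub hab (by simp [Formula.sub, self])
      simp only [Set.mem_ofPred_eq, symbSat_S_zero, hab, hb]
    · constructor
      · intro x i y h; simp only [Set.mem_ofPred_eq, h, true_and, SymbSat]
      · intro x i y h; simp only [Set.mem_ofPred_eq, h, true_and, SymbSat]
      · intro x i y h; simp only [Set.mem_ofPred_eq, h, true_and, SymbSat]
      · intro x y h; simp only [Set.mem_ofPred_eq, h, true_and, SymbSat]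
      · intro a b hab
        have ha : a ∈ φ.sub := hsub hab (by simp [Formula.sub, self])
        have hb : b ∈ φ.sub := hsub hab (by simp [Formula.sub, self])
        simp only [Set.mem_ofPred_eq, hab, ha, hb, true_and, SymbSat]
      · intro a h
        have ha : a ∈ φ.sub := hsub h (by simp [Formula.sub, self])
        simp only [Set.mem_ofPred_eq, h, ha, true_and, SymbSat]
      · intro a h
        have ha : a ∈ φ.sub := hsub h (by simp [Formula.sub, self])
        simp only [Set.mem_ofPred_eq, h, ha, true_and, SymbSat]
      · intro a b hab
        have ha : a ∈ φ.sub := hsub hab (by simp [Formula.sub, self])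
        have hb : b ∈ φ.sub := hsub hab (by simp [Formula.sub, self])
        simp only [Set.mem_ofPred_eq, hab, ha, hb, true_and, symbSat_U_iff ρ n a b]
      · intro a h
        have ha : a ∈ φ.sub := hsub h (by simp [Formula.sub, self])
        simp [h, ha, SymbSat]
      · intro a b hab
        have ha : a ∈ φ.sub := hsub hab (by simp [Formula.sub, self])
        have hb : b ∈ φ.sub := hsub hab (by simp [Formula.sub, self])
        simp only [Set.mem_ofPred_eq, hab, ha, hb, true_and, symbSat_S_succ]
    · rintro F ⟨a, b, hab, rfl⟩ N
      have hb : b ∈ φ.sub := hsub hab (by simp [Formula.sub, self])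
      by_cases hU : SymbSat ρ N (.U a b)
      · obtain ⟨m, hm, hbm, -⟩ := hU
        exact ⟨m, hm, Or.inl ⟨hb, hbm⟩⟩
      · exact ⟨N, le_rfl, Or.inr fun h => hU h.2⟩

end VardiWolper

/-! ## Symbolic satisfaction and satisfaction -/

theorem isRemoteFrame_sat {D : Type*} {R : Type} {r : ℕ} (σ : ℕ → R → D) (n : ℕ) :
    IsRemoteFrame {c : RemoteConstraint R r | c.Sat σ n} where
  refl i x := rfl
  symm i j x y := eq_comm
  trans i j k x y z h1 h2 := Eq.trans h1 h2
  xf_same i x y h z := by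
    simp only [Set.mem_ofPred_eq, RemoteConstraint.Sat] at h ⊢
    rw [h]
  xf_mem i j x y hij h := ⟨n + j, by simpa using hij, h⟩
  xf_iff i j x y hij h z := by
    simp only [Set.mem_ofPred_eq, RemoteConstraint.Sat] at h ⊢
    rw [Fin.lt_def] at hij
    constructor
    · rintro ⟨m, hm, e⟩
      by_cases hmj : n + j < m
      · exact Or.inl ⟨m, hmj, h ▸ e⟩
      · refine Or.inr ⟨⟨m - n, by omega⟩, ?_, ?_, ?_⟩
        · rw [Fin.lt_def]; dsimp; omega
        · rw [Fin.le_def]; dsimp; omega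
        · rw [e]; congr 1; dsimp; omega
    · rintro (⟨m, hm, e⟩ | ⟨k, hik, -, e⟩)
      · exact ⟨m, by omega, h.trans e⟩
      · exact ⟨n + k, by simpa using hik, e⟩

section Satisfaction

variable {D : Type*} [LT D] {L R : Type} {l r : ℕ}

/-- The length bounds are what makes every atom a constraint of `Ω^l ∪ Ω^r`; an atom with a larger
exponent would be symbolically false. -/
theorem symbSat_iff_sat {ρ : ℕ → Frame D L R l r} {σ : ℕ → L → D} {τ : ℕ → R → D}
    (hσ : ∀ n, localProj (ρ n).1 = {c | c.Sat σ n})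
    (hτ : ∀ n, remoteProj (ρ n).1 = {c | c.Sat τ n})
    (ψ : Formula L R) (hl : ψ.localLength ≤ l) (hr : ψ.remoteLength ≤ r) (n : ℕ) :
    SymbSat ρ n ψ ↔ ψ.Sat (fun n => Sum.elim (σ n) (τ n)) n := by
  have hσ' : ∀ n c, Sum.inl c ∈ (ρ n).1 ↔ c.Sat σ n := fun n c => Set.ext_iff.1 (hσ n) c
  have hτ' : ∀ n c, Sum.inr c ∈ (ρ n).1 ↔ c.Sat τ n := fun n c => Set.ext_iff.1 (hτ n) c
  induction ψ generalizing n with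
  | locEq x i y =>
    simp only [Formula.localLength] at hl
    simp only [SymbSat, Formula.Sat, Formula.AtomMem, Formula.IsConstraint, Sum.elim_inl]
    constructor
    · rintro ⟨_, hc, j, rfl, rfl⟩
      simpa [LocalConstraint.Sat] using (hσ' _ _).1 hc
    · intro h
      exact ⟨_, (hσ' _ (.eq 0 x ⟨i, by omega⟩ y)).2 (by simpa [LocalConstraint.Sat] using h),
        _, rfl, rfl⟩
  | locLt x i y =>
    simp only [Formula.localLength] at hl
    simp only [SymbSat, Formula.Sat, Formula.AtomMem, Formula.IsConstraint, Sum.elim_inl]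
    constructor
    · rintro ⟨_, hc, j, rfl, rfl⟩
      simpa [LocalConstraint.Sat] using (hσ' _ _).1 hc
    · intro h
      exact ⟨_, (hσ' _ (.lt 0 x ⟨i, by omega⟩ y)).2 (by simpa [LocalConstraint.Sat] using h),
        _, rfl, rfl⟩
  | remEq x i y =>
    simp only [Formula.remoteLength] at hr
    simp only [SymbSat, Formula.Sat, Formula.AtomMem, Formula.IsConstraint, Sum.elim_inr]
    constructor
    · rintro ⟨_, hc, j, rfl, rfl⟩
      simpa [RemoteConstraint.Sat] using (hτ' _ _).1 hc
    · intro h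
      exact ⟨_, (hτ' _ (.eq 0 x ⟨i, by omega⟩ y)).2 (by simpa [RemoteConstraint.Sat] using h),
        _, rfl, rfl⟩
  | remXF x y =>
    simp only [SymbSat, Formula.Sat, Formula.AtomMem, Formula.IsConstraint, Sum.elim_inr,
      exists_eq_right, hτ', RemoteConstraint.Sat, Fin.val_zero, Nat.add_zero]
  | conj a b iha ihb =>
    simp only [Formula.localLength, Formula.remoteLength, max_le_iff] at hl hr
    simp only [SymbSat, Formula.Sat, iha hl.1 hr.1, ihb hl.2 hr.2]
  | U a b iha ihb =>
    simp only [Formula.localLength, Formula.remoteLength, max_le_iff] at hl hr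
    simp only [SymbSat, Formula.Sat, iha hl.1 hr.1, ihb hl.2 hr.2]
  | S a b iha ihb =>
    simp only [Formula.localLength, Formula.remoteLength, max_le_iff] at hl hr
    simp only [SymbSat, Formula.Sat, iha hl.1 hr.1, ihb hl.2 hr.2]
  | neg a iha => simp only [SymbSat, Formula.Sat, iha hl hr]
  | X a iha => simp only [SymbSat, Formula.Sat, iha hl hr]
  | Xinv a iha => simp only [SymbSat, Formula.Sat, iha hl hr]

theorem isLocalFrame_sat (σ : ℕ → L → D) (n : ℕ) :
    IsLocalFrame D {c : LocalConstraint L l | c.Sat σ n} := by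
  refine ⟨fun m => σ (n + m), ?_⟩
  ext c
  cases c <;> simp [LocalConstraint.Sat]

/-- The sequence of frames of a model. -/
def framesOf (l r : ℕ) (σ : ℕ → L → D) (τ : ℕ → R → D) (n : ℕ) : Frame D L R l r :=
  ⟨{c | Sum.elim (LocalConstraint.Sat σ n) (RemoteConstraint.Sat τ n) c},
    isLocalFrame_sat σ n, isRemoteFrame_sat τ n⟩

theorem isSymbolicModel_framesOf (σ : ℕ → L → D) (τ : ℕ → R → D) :
    IsSymbolicModel (framesOf l r σ τ) := by
  intro n
  refine ⟨⟨fun i j x y => ?_, fun i j x y => ?_⟩, ⟨fun i j x y => ?_, fun i x y => ?_⟩⟩ <;>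
  simp [localProj, remoteProj, framesOf, LocalConstraint.Sat, RemoteConstraint.Sat,
    add_comm, add_left_comm]

end Satisfaction

/-! ## Local symbolic models are realizable -/

section LocalRealizability

variable {D : Type*} [LinearOrder D]

/-- `p` and `q` have the same order type on `s`. -/
def SameOrder {J : Type*} (s : Finset J) (p q : J → D) : Prop :=
  ∀ i ∈ s, ∀ j ∈ s, (p i < p j ↔ q i < q j)

theorem SameOrder.eq_iff {J : Type*} {s : Finset J} {p q : J → D} (h : SameOrder s p q) {i j : J}
    (hi : i ∈ s) (hj : j ∈ s) : p i = p j ↔ q i = q j := by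
  have h1 := h i hi j hj
  have h2 := h j hj i hi
  constructor
  · intro e
    rw [e] at h1 h2
    exact le_antisymm (not_lt.1 fun h => lt_irrefl _ (h2.2 h)) (not_lt.1 fun h => lt_irrefl _ (h1.2 h))
  · intro e
    rw [e] at h1 h2
    exact le_antisymm (not_lt.1 fun h => lt_irrefl _ (h2.1 h)) (not_lt.1 fun h => lt_irrefl _ (h1.1 h))

variable [DenselyOrdered D] [NoMinOrder D] [NoMaxOrder D]

/-- Either the new point coincides with an old one and its image is copied, or it lies in a gap or
beyond the old points. Density and the absence of end points then provide a place in the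
corresponding gap on the other side. -/
theorem SameOrder.exists_insert [Nonempty D] {J : Type*} [DecidableEq J] {s : Finset J}
    {p q : J → D} (h : SameOrder s p q) {k : J} (hk : k ∉ s) :
    ∃ q' : J → D, (∀ i ∈ s, q' i = q i) ∧ SameOrder (insert k s) p q' := by
  suffices ∃ d : D, ∀ i ∈ s, (p k < p i ↔ d < q i) ∧ (p i < p k ↔ q i < d) by
    obtain ⟨d, hd⟩ := this
    have hs : ∀ i ∈ s, i ≠ k := fun i hi e => hk (e ▸ hi)
    refine ⟨Function.update q k d, fun i hi => by simp [hs i hi], ?_⟩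
    intro i hi j hj
    rw [Finset.mem_insert] at hi hj
    rcases hi with rfl | hi <;> rcases hj with rfl | hj
    · simp
    · simp [hs j hj, (hd j hj).1]
    · simp [hs i hi, (hd i hi).2]
    · simp [hs j hj, hs i hi, h i hi j hj]
  by_cases hex : ∃ j ∈ s, p k = p j
  · obtain ⟨j, hj, e⟩ := hex
    exact ⟨q j, fun i hi => by rw [e]; exact ⟨h j hj i hi, h i hi j hj⟩⟩
  · push Not at hex
    obtain ⟨d, h1, h2⟩ := Order.exists_between_finsets ((s.filter fun j => p j < p k).image q)
      ((s.filter fun j => p k < p j).image q) (by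
        intro x hx y hy
        simp only [Finset.mem_image, Finset.mem_filter] at hx hy
        obtain ⟨i, ⟨hi, hik⟩, rfl⟩ := hx
        obtain ⟨j, ⟨hj, hjk⟩, rfl⟩ := hy
        exact (h i hi j hj).1 (hik.trans hjk))
    have h1' : ∀ i ∈ s, p i < p k → q i < d := fun i hi hik =>
      h1 _ (Finset.mem_image_of_mem q (Finset.mem_filter.2 ⟨hi, hik⟩))
    have h2' : ∀ i ∈ s, p k < p i → d < q i := fun i hi hik =>
      h2 _ (Finset.mem_image_of_mem q (Finset.mem_filter.2 ⟨hi, hik⟩))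
    refine ⟨d, fun i hi => ⟨⟨h2' i hi, fun hlt => ?_⟩, ⟨h1' i hi, fun hlt => ?_⟩⟩⟩
    · exact (lt_or_gt_of_ne (hex i hi)).resolve_right fun h => lt_asymm hlt (h1' i hi h)
    · exact (lt_or_gt_of_ne (hex i hi)).resolve_left fun h => lt_asymm hlt (h2' i hi h)

theorem SameOrder.exists_union [Nonempty D] {J : Type*} [DecidableEq J] {s : Finset J}
    {p q : J → D} (h : SameOrder s p q) (t : Finset J) :
    ∃ q' : J → D, (∀ i ∈ s, q' i = q i) ∧ SameOrder (s ∪ t) p q' := by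
  induction t using Finset.induction_on with
  | empty => exact ⟨q, fun _ _ => rfl, by simpa using h⟩
  | insert k t _ ih =>
    obtain ⟨q', h1, h2⟩ := ih
    by_cases hk : k ∈ s ∪ t
    · refine ⟨q', h1, ?_⟩
      rwa [Finset.union_insert, Finset.insert_eq_of_mem hk]
    · obtain ⟨q'', h3, h4⟩ := h2.exists_insert hk
      refine ⟨q'', fun i hi => ?_, ?_⟩
      · rw [h3 i (Finset.mem_union_left _ hi), h1 i hi]
      · rwa [Finset.union_insert]

variable {L : Type} [Finite L] {l : ℕ}

/-- By one-step consistency, the first `l` columns of `G` have the order type of the values already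
chosen at `n + 1, ..., n + l`. Only the column `l`, that is position `n + 1 + l`, has to be added.
-/
theorem exists_local_extension [Nonempty D] {F G : Set (LocalConstraint L l)} (n : ℕ) {τ : ℕ → L → D}
    (hF : F = {c | c.Sat τ n}) (hG : IsLocalFrame D G) (hFG : LocalOneStep F G) :
    ∃ τ' : ℕ → L → D, (∀ m ≤ n + l, τ' m = τ m) ∧ G = {c | c.Sat τ' (n + 1)} := by
  classical
  have := Fintype.ofFinite L
  obtain ⟨μ, hμ⟩ := hG
  let p : ℕ × L → D := fun a => μ a.1 a.2
  let q : ℕ × L → D := fun a => τ (n + 1 + a.1) a.2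
  have h0 : SameOrder (Finset.range l ×ˢ (Finset.univ : Finset L)) p q := by
    rintro ⟨i, x⟩ hi ⟨j, y⟩ hj
    simp only [Finset.mem_product, Finset.mem_range, Finset.mem_univ, and_true] at hi hj
    have := hFG.lt_iff ⟨i, hi⟩ ⟨j, hj⟩ x y
    rw [hF, hμ] at this
    simp only [Set.mem_ofPred_eq, LocalConstraint.Sat, Fin.succ_mk, Fin.castSucc_mk, zero_add]
      at this
    simp only [p, q, ← this]
    rw [show n + (i + 1) = n + 1 + i by omega, show n + (j + 1) = n + 1 + j by omega]
  obtain ⟨q', h1, h2⟩ := h0.exists_union ({l} ×ˢ (Finset.univ : Finset L))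
  have hmem : ∀ (i : Fin (l + 1)) (x : L), ((i : ℕ), x) ∈
      (Finset.range l ×ˢ (Finset.univ : Finset L)) ∪ ({l} ×ˢ (Finset.univ : Finset L)) := by
    intro i x
    simp only [Finset.mem_union, Finset.mem_product, Finset.mem_range, Finset.mem_univ, and_true,
      Finset.mem_singleton]
    omega
  let τ' : ℕ → L → D := fun m x => if m ≤ n + l then τ m x else q' (l, x)
  have hval : ∀ (i : Fin (l + 1)) (x : L), τ' (n + 1 + i) x = q' (i, x) := by
    intro i x
    by_cases hi : (i : ℕ) < l
    · rw [h1 _ (by simpa using hi)]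
      simp only [τ', q]
      rw [if_pos (by omega)]
    · have hi' : (i : ℕ) = l := by omega
      simp only [τ', hi']
      rw [if_neg (by omega)]
  refine ⟨τ', fun m hm => by ext x; simp [τ', hm], ?_⟩
  rw [hμ]
  ext c
  cases c with
  | eq i x j y =>
    simp only [Set.mem_ofPred_eq, LocalConstraint.Sat, hval, zero_add]
    exact h2.eq_iff (hmem i x) (hmem j y)
  | lt i x j y =>
    simp only [Set.mem_ofPred_eq, LocalConstraint.Sat, hval, zero_add]
    exact h2 _ (hmem i x) _ (hmem j y)

/-- Over a dense open order, every symbolic model has a realizable local projection. -/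
theorem exists_local_realization [Nonempty D] {F : ℕ → Set (LocalConstraint L l)}
    (hF : ∀ n, IsLocalFrame D (F n)) (hstep : ∀ n, LocalOneStep (F n) (F (n + 1))) :
    ∃ σ : ℕ → L → D, ∀ n, F n = {c | c.Sat σ n} := by
  let S := fun n => {τ : ℕ → L → D // F n = {c | c.Sat τ n}}
  have hnext : ∀ n (τ : S n), ∃ τ' : S (n + 1), ∀ m ≤ n + l, τ'.1 m = τ.1 m := by
    intro n τ
    obtain ⟨τ', h1, h2⟩ := exists_local_extension n τ.2 (hF (n + 1)) (hstep n)
    exact ⟨⟨τ', h2⟩, h1⟩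
  choose nxt hnxt using hnext
  obtain ⟨τ₀, h₀⟩ := hF 0
  let s : ∀ n, S n := fun n => Nat.rec (motive := S) ⟨τ₀, h₀⟩ nxt n
  have hs : ∀ n m, m ≤ n + l → (s (n + 1)).1 m = (s n).1 m := fun n => hnxt n (s n)
  have hs' : ∀ d n m, m ≤ n + l → (s (n + d)).1 m = (s n).1 m := by
    intro d
    induction d with
    | zero => intros; rfl
    | succ d ih =>
      intro n m hm
      rw [← ih n m hm]
      exact hs (n + d) m (by omega)
  have hval : ∀ n (i : Fin (l + 1)), (s (n + i)).1 (n + i) = (s n).1 (n + i) :=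
    fun n i => hs' i n (n + i) (by omega)
  -- Diagonal sequence: stage `n` fixes all positions up to `n + l` for good, so the value at `m` no
  -- longer changes from stage `m` on.
  refine ⟨fun m => (s m).1 m, fun n => ?_⟩
  rw [(s n).2]
  ext c
  cases c <;> simp [LocalConstraint.Sat, hval]

end LocalRealizability

/-! ## Occurrences in a remote symbolic model -/

section Occurrences

variable {R : Type} {r : ℕ}

/-- A sequence of `r`-frames whose consecutive pairs are one-step consistent. -/
structure IsRemoteModel (F : ℕ → Set (RemoteConstraint R r)) : Prop where
  frame : ∀ n, IsRemoteFrame (F n)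
  step : ∀ n, RemoteOneStep (F n) (F (n + 1))

/-- Some frame states that the occurrences `a` and `b` have the same value. -/
def Linked (F : ℕ → Set (RemoteConstraint R r)) (a b : ℕ × R) : Prop :=
  ∃ (k : ℕ) (i j : Fin (r + 1)), a.1 = k + i ∧ b.1 = k + j ∧ .eq i a.2 j b.2 ∈ F k

/-- The value of the occurrence `a` has to be repeated later in `z`. -/
def Due (F : ℕ → Set (RemoteConstraint R r)) (a : ℕ × R) (z : R) : Prop :=
  .xf 0 a.2 z ∈ F a.1

variable {F : ℕ → Set (RemoteConstraint R r)}

namespace IsRemoteModel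

theorem eq_shift (hF : IsRemoteModel F) (t k i j : ℕ) (x y : R) (hi : i + t < r + 1)
    (hj : j + t < r + 1) : .eq ⟨i + t, hi⟩ x ⟨j + t, hj⟩ y ∈ F k ↔
      .eq ⟨i, by omega⟩ x ⟨j, by omega⟩ y ∈ F (k + t) := by
  induction t generalizing k with
  | zero => rfl
  | succ t ih =>
    have h1 := (hF.step k).eq_iff ⟨i + t, by omega⟩ ⟨j + t, by omega⟩ x y
    simp only [Fin.succ_mk, Fin.castSucc_mk] at h1
    rw [show k + (t + 1) = k + 1 + t by omega, ← ih (k + 1) (by omega) (by omega), ← h1]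
    rfl

theorem linked_iff (hF : IsRemoteModel F) (k : ℕ) (i j : Fin (r + 1)) (x y : R) :
    Linked F (k + i, x) (k + j, y) ↔ .eq i x j y ∈ F k := by
  refine ⟨?_, fun h => ⟨k, i, j, rfl, rfl, h⟩⟩
  rintro ⟨k', i', j', hi, hj, h⟩
  dsimp only at hi hj h
  rcases le_total k k' with hk | hk
  · obtain ⟨t, rfl⟩ := Nat.exists_eq_add_of_le hk
    have := (hF.eq_shift t k i' j' x y (by omega) (by omega)).2 h
    convert this using 2 <;> ext <;> dsimp <;> omega
  · obtain ⟨t, rfl⟩ := Nat.exists_eq_add_of_le hk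
    refine (hF.eq_shift t k' i j x y (by omega) (by omega)).1 ?_
    convert h using 2 <;> ext <;> dsimp <;> omega

theorem due_iff (hF : IsRemoteModel F) (k : ℕ) (i : Fin (r + 1)) (x z : R) :
    Due F (k + i, x) z ↔ .xf i x z ∈ F k := by
  obtain ⟨i, hi⟩ := i
  induction i generalizing k with
  | zero => rfl
  | succ i ih =>
    have h1 := (hF.step k).xf_iff ⟨i, by omega⟩ x z
    simp only [Fin.succ_mk, Fin.castSucc_mk] at h1
    rw [h1, ← ih (k + 1) (by omega)]
    dsimp only
    rw [show k + (i + 1) = k + 1 + i by omega]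

theorem linked_iff_mem (hF : IsRemoteModel F) {k : ℕ} {a b : ℕ × R} (h1 : k ≤ a.1) (h2 : k ≤ b.1)
    (h3 : a.1 ≤ k + r) (h4 : b.1 ≤ k + r) :
    Linked F a b ↔ .eq ⟨a.1 - k, by omega⟩ a.2 ⟨b.1 - k, by omega⟩ b.2 ∈ F k := by
  rw [← hF.linked_iff]
  dsimp only
  rw [Nat.add_sub_cancel' h1, Nat.add_sub_cancel' h2]

theorem linked_refl (hF : IsRemoteModel F) (a : ℕ × R) : Linked F a a :=
  ⟨a.1, 0, 0, rfl, rfl, (hF.frame _).refl _ _⟩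

theorem linked_symm (hF : IsRemoteModel F) {a b : ℕ × R} : Linked F a b → Linked F b a := by
  rintro ⟨k, i, j, h1, h2, h⟩
  exact ⟨k, j, i, h2, h1, ((hF.frame _).symm _ _ _ _).1 h⟩

theorem _root_.CLRV.Linked.dist {a b : ℕ × R} : Linked F a b → a.1 ≤ b.1 + r ∧ b.1 ≤ a.1 + r := by
  rintro ⟨k, i, j, h1, h2, -⟩
  omega

/-- Transitivity is available only inside a common window of length `r`. Without it, being linked is
not transitive, which is why threads are needed. -/
theorem linked_trans (hF : IsRemoteModel F) {a b c : ℕ × R} (k : ℕ) (ha : k ≤ a.1)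
    (hb : k ≤ b.1) (hc : k ≤ c.1) (ha' : a.1 ≤ k + r) (hb' : b.1 ≤ k + r) (hc' : c.1 ≤ k + r)
    (h1 : Linked F a b) (h2 : Linked F b c) : Linked F a c := by
  rw [hF.linked_iff_mem ha hb ha' hb'] at h1
  rw [hF.linked_iff_mem hb hc hb' hc'] at h2
  rw [hF.linked_iff_mem ha hc ha' hc']
  exact (hF.frame k).trans _ _ _ _ _ _ h1 h2

theorem due_congr (hF : IsRemoteModel F) {a b : ℕ × R} (hab : a.1 = b.1) (h : Linked F a b) (z : R) :
    Due F a z ↔ Due F b z := by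
  obtain ⟨n, x⟩ := a
  obtain ⟨m, y⟩ := b
  obtain rfl : n = m := hab
  exact (hF.frame n).xf_same 0 x y ((hF.linked_iff n 0 0 x y).1 h) z

theorem due_iff_of_linked (hF : IsRemoteModel F) {a b : ℕ × R} (hab : a.1 < b.1)
    (h : Linked F a b) (z : R) :
    Due F a z ↔ Due F b z ∨ ∃ k, a.1 < k ∧ k ≤ b.1 ∧ Linked F a (k, z) := by
  have h' := h.dist
  have h0 := h
  rw [hF.linked_iff_mem le_rfl hab.le (by omega) h'.2] at h
  have h2 := (hF.frame a.1).xf_iff 0 ⟨b.1 - a.1, by omega⟩ a.2 b.2 (by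
    rw [Fin.lt_def]; dsimp; omega) (by convert h using 2; ext; simp) z
  rw [← hF.due_iff, ← hF.due_iff] at h2
  dsimp only [Fin.val_zero] at h2
  rw [Nat.add_zero, Nat.add_sub_cancel' hab.le] at h2
  rw [h2]
  refine or_congr Iff.rfl ⟨?_, ?_⟩
  · rintro ⟨k, hk1, hk2, hk⟩
    rw [Fin.lt_def, Fin.val_zero] at hk1
    rw [Fin.le_def] at hk2
    dsimp only at hk2
    exact ⟨a.1 + k, by omega, by omega, (hF.linked_iff _ 0 k _ _).2 hk⟩
  · rintro ⟨k, hk1, hk2, hk⟩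
    refine ⟨⟨k - a.1, by omega⟩, ?_, ?_, ?_⟩
    · rw [Fin.lt_def]; dsimp; omega
    · rw [Fin.le_def]; dsimp; omega
    · rw [← hF.linked_iff]
      dsimp only
      rwa [Nat.add_sub_cancel' hk1.le]

/-- One-step consistency makes all frames agree on a constraint, so the conditions can be checked on
pairs of occurrences instead of frame by frame. -/
theorem realized_of (hF : IsRemoteModel F) {D : Type*} {σ : ℕ → R → D}
    (h1 : ∀ a b : ℕ × R, a.1 ≤ b.1 + r → b.1 ≤ a.1 + r → (Linked F a b ↔ σ a.1 a.2 = σ b.1 b.2))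
    (h2 : ∀ (a : ℕ × R) z, Due F a z ↔ ∃ m, a.1 < m ∧ σ a.1 a.2 = σ m z) (n : ℕ) :
    F n = {c | c.Sat σ n} := by
  ext c
  cases c with
  | eq i x j y =>
    rw [← hF.linked_iff, h1 _ _ (by dsimp; omega) (by dsimp; omega)]
    rfl
  | xf i x z =>
    rw [← hF.due_iff, h2]
    rfl

end IsRemoteModel

/-- A representative of the class of `a` at its position. -/
noncomputable def canon (F : ℕ → Set (RemoteConstraint R r)) (a : ℕ × R) : ℕ × R :=
  (a.1, @Classical.epsilon R ⟨a.2⟩ fun y => Linked F a (a.1, y))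

theorem canon_fst (a : ℕ × R) : (canon F a).1 = a.1 := rfl

theorem IsRemoteModel.linked_canon (hF : IsRemoteModel F) (a : ℕ × R) : Linked F a (canon F a) :=
  @Classical.epsilon_spec R (fun y => Linked F a (a.1, y)) ⟨a.2, hF.linked_refl a⟩

theorem IsRemoteModel.canon_congr (hF : IsRemoteModel F) {a b : ℕ × R} (hab : a.1 = b.1)
    (h : Linked F a b) : canon F a = canon F b := by
  have : (fun y => Linked F a (a.1, y)) = fun y => Linked F b (b.1, y) := by
    ext y
    rw [← hab]
    constructor
    · exact hF.linked_trans a.1 (by omega) (by omega) le_rfl (by omega) (by omega) (by simp)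
        (hF.linked_symm h)
    · exact hF.linked_trans a.1 (by omega) (by omega) le_rfl (by omega) (by omega) (by simp) h
  refine Prod.ext hab ?_
  simp only [canon, this]

theorem IsRemoteModel.canon_canon (hF : IsRemoteModel F) (a : ℕ × R) :
    canon F (canon F a) = canon F a :=
  (hF.canon_congr (canon_fst a).symm (hF.linked_canon a)).symm

theorem IsRemoteModel.linked_canon_canon (hF : IsRemoteModel F) {a b : ℕ × R} (h1 : a.1 ≤ b.1)
    (h2 : b.1 ≤ a.1 + r) : Linked F (canon F a) (canon F b) ↔ Linked F a b := by
  have ha := hF.linked_canon a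
  have hb := hF.linked_canon b
  have ha' := hF.linked_symm ha
  have hb' := hF.linked_symm hb
  constructor
  · intro h
    exact hF.linked_trans (b := canon F b) a.1 le_rfl h1 h1 (by simp) h2 h2
      (hF.linked_trans a.1 le_rfl (canon_fst a).ge h1 (by omega) (by simp [canon_fst]) h2 ha h) hb'
  · intro h
    exact hF.linked_trans a.1 le_rfl h1 h1 (by simp [canon_fst]) h2 h2
      (hF.linked_trans a.1 le_rfl le_rfl h1 (by simp [canon_fst]) (by omega) h2 ha' h) hb

/-- `b` is the next class in the thread of `a`. -/
structure ThreadStep (F : ℕ → Set (RemoteConstraint R r)) (a b : ℕ × R) : Prop where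
  canon_left : canon F a = a
  canon_right : canon F b = b
  lt : a.1 < b.1
  linked : Linked F a b
  nearest : ∀ c : ℕ × R, a.1 < c.1 → c.1 < b.1 → ¬ Linked F a c

/-- The thread of `a` ends with `a`, and its value is to be repeated in `Y`. -/
structure IsThreadEnd (F : ℕ → Set (RemoteConstraint R r)) (Y : Set R) (a : ℕ × R) : Prop where
  canon_eq : canon F a = a
  not_linked : ∀ b : ℕ × R, a.1 < b.1 → ¬ Linked F a b
  type : {z | Due F a z} = Y

/-- The thread of `a` starts with `a`, and its value occurs now or later in `Y`. -/
structure IsThreadStart (F : ℕ → Set (RemoteConstraint R r)) (Y : Set R) (a : ℕ × R) : Prop where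
  canon_eq : canon F a = a
  not_linked : ∀ b : ℕ × R, b.1 < a.1 → ¬ Linked F b a
  type : {z | Linked F a (a.1, z) ∨ Due F a z} = Y

/-- On the thread from `a` on, `z` occurs or the set of variables that are due is not `Y`. -/
def Good (F : ℕ → Set (RemoteConstraint R r)) (Y : Set R) (z : R) (a : ℕ × R) : Prop :=
  ∃ b, Relation.ReflTransGen (ThreadStep F) a b ∧ (Linked F b (b.1, z) ∨ {z | Due F b z} ≠ Y)

theorem IsRemoteModel.threadStep_right_unique (hF : IsRemoteModel F) {a b c : ℕ × R}
    (h1 : ThreadStep F a b) (h2 : ThreadStep F a c) : b = c := by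
  have hbc : b.1 = c.1 := by
    rcases lt_trichotomy b.1 c.1 with h | h | h
    · exact (h2.nearest b h1.lt h h1.linked).elim
    · exact h
    · exact (h1.nearest c h2.lt h h2.linked).elim
  have h3 := h1.linked.dist
  have h4 := h1.lt
  rw [← h1.canon_right, ← h2.canon_right]
  exact hF.canon_congr hbc (hF.linked_trans a.1 (by omega) (by omega) (by omega) (by omega)
    (by omega) (by omega) (hF.linked_symm h1.linked) h2.linked)

/-- Two predecessors lie with `c` in one window and are therefore linked. If one came later than the
other, it would be a nearer successor of the earlier one than `c`. -/
theorem IsRemoteModel.threadStep_left_unique (hF : IsRemoteModel F) {a b c : ℕ × R}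
    (h1 : ThreadStep F a c) (h2 : ThreadStep F b c) : a = b := by
  wlog hab : a.1 ≤ b.1 generalizing a b
  · exact (this h2 h1 (by omega)).symm
  have h3 := h1.linked.dist
  have h4 := h2.lt
  have hl : Linked F a b := hF.linked_trans a.1 (by omega) (by omega) (by omega) (by omega)
    (by omega) (by omega) h1.linked (hF.linked_symm h2.linked)
  rcases hab.eq_or_lt with e | hlt
  · rw [← h1.canon_left, ← h2.canon_left]
    exact hF.canon_congr e hl
  · exact (h1.nearest b hlt h4 hl).elim

theorem IsRemoteModel.exists_threadStep (hF : IsRemoteModel F) {a b : ℕ × R} (ha : canon F a = a)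
    (hab : a.1 < b.1) (h : Linked F a b) : ∃ c, ThreadStep F a c ∧ c.1 ≤ b.1 := by
  classical
  have hex : ∃ k, a.1 < k ∧ ∃ y, Linked F a (k, y) := ⟨b.1, hab, b.2, h⟩
  obtain ⟨h1, y, h2⟩ := Nat.find_spec hex
  have hle : Nat.find hex ≤ b.1 := Nat.find_min' hex ⟨hab, b.2, h⟩
  have h3 := h.dist
  refine ⟨canon F (Nat.find hex, y), ⟨ha, hF.canon_canon _, h1, ?_, ?_⟩, hle⟩
  · exact hF.linked_trans a.1 le_rfl h1.le h1.le (by omega) (by dsimp; omega)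
      (by simp only [canon_fst]; omega) h2 (hF.linked_canon _)
  · intro c hc1 hc2 hc
    exact Nat.find_min hex hc2 ⟨hc1, c.2, hc⟩

theorem IsRemoteModel.reflTransGen_of_linked (hF : IsRemoteModel F) {a b : ℕ × R}
    (ha : canon F a = a) (hb : canon F b = b) (hab : a.1 ≤ b.1) (h : Linked F a b) :
    Relation.ReflTransGen (ThreadStep F) a b := by
  induction hd : b.1 - a.1 using Nat.strong_induction_on generalizing a with
  | _ d ih =>
  rcases hab.eq_or_lt with e | hlt
  · rw [← ha, ← hb, hF.canon_congr e h]
  · obtain ⟨c, hc, hcb⟩ := hF.exists_threadStep ha hlt h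
    have h1 := hc.lt
    have h3 := h.dist
    refine Relation.ReflTransGen.head hc (ih (b.1 - c.1) (by omega) hc.canon_right hcb ?_ rfl)
    exact hF.linked_trans a.1 h1.le le_rfl hab (by omega) (by omega) (by omega)
      (hF.linked_symm hc.linked) h

theorem IsRemoteModel.reflTransGen_canon (hF : IsRemoteModel F) {a b : ℕ × R} (hab : a.1 ≤ b.1)
    (h : Linked F a b) : Relation.ReflTransGen (ThreadStep F) (canon F a) (canon F b) :=
  hF.reflTransGen_of_linked (hF.canon_canon a) (hF.canon_canon b) hab
    ((hF.linked_canon_canon hab h.dist.2).2 h)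

/-- In the frame condition for linked occurrences, positions strictly between `a` and `b` contribute
nothing, since `b` is the nearest class linked with `a`. -/
theorem IsRemoteModel.due_iff_of_threadStep (hF : IsRemoteModel F) {a b : ℕ × R}
    (h : ThreadStep F a b) (z : R) : Due F a z ↔ Linked F b (b.1, z) ∨ Due F b z := by
  have h1 := h.linked.dist
  have h2 := h.lt
  rw [hF.due_iff_of_linked h.lt h.linked, or_comm]
  refine or_congr_left ⟨?_, fun hz => ⟨b.1, h.lt, le_rfl, ?_⟩⟩
  · rintro ⟨k, hk1, hk2, hk⟩
    rcases hk2.eq_or_lt with rfl | hlt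
    · exact hF.linked_trans a.1 h2.le le_rfl h2.le (by omega) (by omega) (by dsimp; omega)
        (hF.linked_symm h.linked) hk
    · exact (h.nearest (k, z) hk1 hlt hk).elim
  · exact hF.linked_trans a.1 le_rfl h2.le h2.le (by omega) (by omega) (by dsimp; omega)
      h.linked hz

theorem IsRemoteModel.due_canon (hF : IsRemoteModel F) (a : ℕ × R) (z : R) :
    Due F (canon F a) z ↔ Due F a z :=
  (hF.due_congr (canon_fst a).symm (hF.linked_canon a) z).symm

/-! ### Values as chains of threads. -/

theorem reflTransGen_or_of_eqvGen {α : Type*} {S : α → α → Prop}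
    (h1 : ∀ a b c, S a b → S a c → b = c) (h2 : ∀ a b c, S a c → S b c → a = b) {a b : α}
    (h : Relation.EqvGen S a b) : Relation.ReflTransGen S a b ∨ Relation.ReflTransGen S b a := by
  induction h with
  | rel x y h => exact Or.inl (.single h)
  | refl x => exact Or.inl .refl
  | symm x y _ ih => exact ih.symm
  | trans x y z _ _ ih1 ih2 =>
    rcases ih1 with h3 | h3 <;> rcases ih2 with h4 | h4
    · exact Or.inl (h3.trans h4)
    · have h5 := Relation.ReflTransGen.total_of_right_unique (r := Function.swap S)
        (fun a b c h h' => h2 _ _ _ h h') (Relation.ReflTransGen.swap _ _ h3) (Relation.ReflTransGen.swap _ _ h4)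
      exact h5.symm.imp (Relation.ReflTransGen.swap _ _) (Relation.ReflTransGen.swap _ _)
    · exact Relation.ReflTransGen.total_of_right_unique (fun a b c h h' => h1 _ _ _ h h') h3 h4
    · exact Or.inr (h4.trans h3)

/-- `b` is the next class of the value of `a`, where the end `a` of a thread of type `Y` is
continued by the thread that starts with `f Y a`. -/
def ValueStep (F : ℕ → Set (RemoteConstraint R r)) (f : RCounter R → ℕ × R → ℕ × R)
    (a b : ℕ × R) : Prop :=
  ThreadStep F a b ∨ ∃ Y : RCounter R, IsThreadEnd F Y.1 a ∧ b = f Y a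

/-- `f` continues every end of type `Y` by a later start of type `Y`, in such a way that all
variables of `Y` are met. -/
structure IsContinuation (F : ℕ → Set (RemoteConstraint R r)) (Y : Set R) (f : ℕ × R → ℕ × R) :
    Prop where
  start : ∀ a, IsThreadEnd F Y a → IsThreadStart F Y (f a)
  lt : ∀ a, IsThreadEnd F Y a → a.1 + r < (f a).1
  inj : ∀ a b, IsThreadEnd F Y a → IsThreadEnd F Y b → f a = f b → a = b
  fair : ∀ z ∈ Y, ∀ a : ℕ → ℕ × R,
    (∀ k, ThreadStep F (a k) (a (k + 1)) ∨ (IsThreadEnd F Y (a k) ∧ a (k + 1) = f (a k))) →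
    (∀ N, ∃ k, N ≤ k ∧ IsThreadEnd F Y (a k)) → ∃ k, Good F Y z (a k)

section ValueStep

variable {f : RCounter R → ℕ × R → ℕ × R}

theorem ValueStep.lt (hf : ∀ Y, IsContinuation F Y.1 (f Y)) {a b : ℕ × R}
    (h : ValueStep F f a b) : a.1 < b.1 := by
  rcases h with h | ⟨Y, h, rfl⟩
  · exact h.lt
  · have := (hf Y).lt a h
    omega

theorem ValueStep.canon_right (hf : ∀ Y, IsContinuation F Y.1 (f Y)) {a b : ℕ × R}
    (h : ValueStep F f a b) : canon F b = b := by
  rcases h with h | ⟨Y, h, rfl⟩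
  · exact h.canon_right
  · exact ((hf Y).start a h).canon_eq

theorem IsThreadEnd.type_unique {Y Y' : RCounter R} {a : ℕ × R} (h : IsThreadEnd F Y.1 a)
    (h' : IsThreadEnd F Y'.1 a) : Y = Y' :=
  Subtype.ext (h.type.symm.trans h'.type)

theorem IsThreadStart.type_unique {Y Y' : RCounter R} {a : ℕ × R} (h : IsThreadStart F Y.1 a)
    (h' : IsThreadStart F Y'.1 a) : Y = Y' :=
  Subtype.ext (h.type.symm.trans h'.type)

theorem IsRemoteModel.valueStep_right_unique (hF : IsRemoteModel F) (a b c : ℕ × R)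
    (h1 : ValueStep F f a b) (h2 : ValueStep F f a c) : b = c := by
  rcases h1 with h1 | ⟨Y, h1, rfl⟩ <;> rcases h2 with h2 | ⟨Y', h2, rfl⟩
  · exact hF.threadStep_right_unique h1 h2
  · exact (h2.not_linked b h1.lt h1.linked).elim
  · exact (h1.not_linked c h2.lt h2.linked).elim
  · rw [h1.type_unique h2]

theorem IsRemoteModel.valueStep_left_unique (hF : IsRemoteModel F)
    (hf : ∀ Y, IsContinuation F Y.1 (f Y)) (a b c : ℕ × R)
    (h1 : ValueStep F f a c) (h2 : ValueStep F f b c) : a = b := by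
  rcases h1 with h1 | ⟨Y, h1, rfl⟩ <;> rcases h2 with h2 | ⟨Y', h2, e⟩
  · exact hF.threadStep_left_unique h1 h2
  · subst e
    exact (((hf Y').start b h2).not_linked a h1.lt h1.linked).elim
  · exact (((hf Y).start a h1).not_linked b h2.lt h2.linked).elim
  · obtain rfl := ((hf Y).start a h1).type_unique (e ▸ (hf Y').start b h2)
    exact (hf Y).inj a b h1 h2 e

/-- At a jump from one thread to the next this is exactly the equality of the type of the end with
the type of the start. -/
theorem IsRemoteModel.due_iff_of_valueStep (hF : IsRemoteModel F)
    (hf : ∀ Y, IsContinuation F Y.1 (f Y)) {a b : ℕ × R} (h : ValueStep F f a b) (z : R) :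
    Due F a z ↔ Linked F b (b.1, z) ∨ Due F b z := by
  rcases h with h | ⟨Y, h, rfl⟩
  · exact hF.due_iff_of_threadStep h z
  · exact Set.ext_iff.1 (h.type.trans ((hf Y).start a h).type.symm) z

theorem le_of_reflTransGen_valueStep (hf : ∀ Y, IsContinuation F Y.1 (f Y)) {a b : ℕ × R}
    (h : Relation.ReflTransGen (ValueStep F f) a b) : a.1 ≤ b.1 := by
  induction h with
  | refl => exact le_rfl
  | tail _ h ih => exact ih.trans (h.lt hf).le

/-- A jump to another thread covers more than `r` positions, so a path inside a window uses thread
steps only. Hence gluing threads creates no equality that a frame could see. -/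
theorem IsRemoteModel.linked_of_reflTransGen (hF : IsRemoteModel F)
    (hf : ∀ Y, IsContinuation F Y.1 (f Y)) {a b : ℕ × R}
    (h : Relation.ReflTransGen (ValueStep F f) a b) (hab : b.1 ≤ a.1 + r) : Linked F a b := by
  induction h using Relation.ReflTransGen.head_induction_on with
  | refl => exact hF.linked_refl b
  | @head a c hac hcb ih =>
    have h1 := hac.lt hf
    have h2 := le_of_reflTransGen_valueStep hf hcb
    rcases hac with hac | ⟨Y, hac, rfl⟩
    · exact hF.linked_trans a.1 le_rfl h1.le (by omega) (by omega) (by omega) hab hac.linked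
        (ih (by omega))
    · have := (hf Y).lt a hac
      omega

theorem IsRemoteModel.occurs_or_due_of_reflTransGen (hF : IsRemoteModel F)
    (hf : ∀ Y, IsContinuation F Y.1 (f Y)) {a b : ℕ × R} {z : R}
    (h : Relation.ReflTransGen (ValueStep F f) a b) (hb : Linked F b (b.1, z)) :
    Linked F a (a.1, z) ∨ Due F a z := by
  induction h using Relation.ReflTransGen.head_induction_on with
  | refl => exact Or.inl hb
  | head hac _ ih => exact Or.inr ((hF.due_iff_of_valueStep hf hac z).2 ih)

theorem IsRemoteModel.exists_valueStep (hF : IsRemoteModel F) {a : ℕ × R}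
    (ha : canon F a = a) {z : R} (hz : Due F a z) : ∃ b, ValueStep F f a b := by
  by_cases h : ∃ b : ℕ × R, a.1 < b.1 ∧ Linked F a b
  · obtain ⟨b, hab, hb⟩ := h
    obtain ⟨c, hc, -⟩ := hF.exists_threadStep ha hab hb
    exact ⟨c, Or.inl hc⟩
  · push Not at h
    exact ⟨_, Or.inr ⟨⟨{z | Due F a z}, ⟨z, hz⟩⟩, ⟨ha, h, rfl⟩, rfl⟩⟩

/-- A value that is due in `z` is met in `z`. -/
theorem IsRemoteModel.exists_reflTransGen_of_due [Finite R] (hF : IsRemoteModel F)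
    (hf : ∀ Y, IsContinuation F Y.1 (f Y))
    (hpend : ∀ (a : ℕ → ℕ × R) (z : R), (∀ k, ThreadStep F (a k) (a (k + 1))) → Due F (a 0) z →
      ∃ k, Linked F (a (k + 1)) ((a (k + 1)).1, z))
    {a : ℕ × R} (ha : canon F a = a) {z : R} (hz : Due F a z) :
    ∃ b, Relation.ReflTransGen (ValueStep F f) a b ∧ a.1 < b.1 ∧ Linked F b (b.1, z) := by
  by_contra hcon
  push Not at hcon
  let X := {b : ℕ × R // Relation.ReflTransGen (ValueStep F f) a b ∧ canon F b = b ∧ Due F b z}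
  have hnext : ∀ b : X, ∃ c : X, ValueStep F f b.1 c.1 := by
    rintro ⟨b, h1, h2, h3⟩
    obtain ⟨c, hc⟩ := hF.exists_valueStep (f := f) h2 h3
    have h4 := hc.lt hf
    have h5 := le_of_reflTransGen_valueStep hf h1
    refine ⟨⟨c, h1.tail hc, hc.canon_right hf, ?_⟩, hc⟩
    exact ((hF.due_iff_of_valueStep hf hc z).1 h3).resolve_left (hcon c (h1.tail hc) (by omega))
  choose nxt hnxt using hnext
  -- The chain begins with a proper successor of `a`, so that all its members lie after `a` and miss
  -- `z` by assumption.
  let s : ℕ → X := fun n => nxt^[n + 1] ⟨a, .refl, ha, hz⟩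
  have hs : ∀ n, ValueStep F f (s n).1 (s (n + 1)).1 := by
    intro n
    simp only [s]
    rw [Function.iterate_succ_apply' nxt (n + 1)]
    exact hnxt _
  have hpos : ∀ n, a.1 < (s n).1.1 := by
    intro n
    simp only [s]
    rw [Function.iterate_succ_apply']
    exact (le_of_reflTransGen_valueStep hf (nxt^[n] _).2.1).trans_lt ((hnxt _).lt hf)
  have hmiss : ∀ n, ¬ Linked F (s n).1 ((s n).1.1, z) := fun n => hcon _ (s n).2.1 (hpos n)
  let Dz : ℕ → Set R := fun n => {z | Due F (s n).1 z}
  have hanti : Antitone Dz := antitone_nat_of_succ_le fun n w hw =>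
    (hF.due_iff_of_valueStep hf (hs n) w).2 (Or.inr hw)
  -- Due sets decrease along the chain and are finite, hence constant from some `k₀` on; all ends
  -- after `k₀` have this one type `Y`.
  obtain ⟨k₀, hk₀⟩ : ∃ k₀, ∀ k, (Dz k₀).ncard ≤ (Dz k).ncard := by
    obtain ⟨k₀, -, h⟩ := WellFounded.has_min (measure fun k => (Dz k).ncard).wf Set.univ
      ⟨0, trivial⟩
    exact ⟨k₀, fun k => not_lt.1 (h k trivial)⟩
  have hconst : ∀ k, k₀ ≤ k → Dz k = Dz k₀ := fun k hk =>
    Set.eq_of_subset_of_ncard_le (hanti hk) (hk₀ k) (Set.toFinite _)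
  let Y : RCounter R := ⟨Dz k₀, z, (s k₀).2.2.2⟩
  have hstep : ∀ k, ThreadStep F (s (k₀ + k)).1 (s (k₀ + (k + 1))).1 ∨
      (IsThreadEnd F Y.1 (s (k₀ + k)).1 ∧ (s (k₀ + (k + 1))).1 = f Y (s (k₀ + k)).1) := by
    intro k
    rcases hs (k₀ + k) with h | ⟨Y', h, e⟩
    · exact Or.inl h
    · obtain rfl : Y' = Y :=
        Subtype.ext (h.type.symm.trans (hconst (k₀ + k) (by omega)))
      exact Or.inr ⟨h, e⟩
  -- Infinitely many ends contradict fairness; finitely many leave an infinite thread on which `z`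
  -- is due but never met, contradicting `hpend`.
  by_cases hinf : ∀ N, ∃ k, N ≤ k ∧ IsThreadEnd F Y.1 (s (k₀ + k)).1
  · obtain ⟨k, b, hb, hgood⟩ := (hf Y).fair z (s k₀).2.2.2 (fun k => (s (k₀ + k)).1) hstep hinf
    obtain ⟨j, rfl⟩ : ∃ j, b = (s (k₀ + j)).1 := by
      clear hgood
      induction hb with
      | refl => exact ⟨k, rfl⟩
      | tail _ h ih =>
        obtain ⟨j, rfl⟩ := ih
        exact ⟨j + 1, hF.valueStep_right_unique (f := f) _ _ _ (Or.inl h) (hs (k₀ + j))⟩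
    rcases hgood with h | h
    · exact hmiss _ h
    · exact h (hconst _ (by omega))
  · push Not at hinf
    obtain ⟨N, hN⟩ := hinf
    obtain ⟨k, hk⟩ := hpend (fun k => (s (k₀ + (N + k))).1) z
      (fun k => (hstep (N + k)).resolve_right fun h => hN _ (by omega) h.1) (s _).2.2.2
    exact hmiss _ hk

/-- Values are the classes of the equivalence generated by `ValueStep`, of which there are countably
many, embedded injectively into the infinite set `D`. As the relation is injective in both
directions, each class is a single chain, so equality of values means reachability. -/
theorem IsRemoteModel.exists_realization [Finite R] {D : Type*} [Infinite D] (hF : IsRemoteModel F)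
    (hf : ∀ Y, IsContinuation F Y.1 (f Y))
    (hpend : ∀ (a : ℕ → ℕ × R) (z : R), (∀ k, ThreadStep F (a k) (a (k + 1))) → Due F (a 0) z →
      ∃ k, Linked F (a (k + 1)) ((a (k + 1)).1, z)) :
    ∃ σ : ℕ → R → D, ∀ n, F n = {c | c.Sat σ n} := by
  have : Countable R := Finite.to_countable
  obtain ⟨ι, hι⟩ := exists_injective_nat (Quot (ValueStep F f))
  let e := Infinite.natEmbedding D
  let σ : ℕ → R → D := fun n x => e (ι (Quot.mk _ (canon F (n, x))))
  have hσ : ∀ a b : ℕ × R, σ a.1 a.2 = σ b.1 b.2 ↔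
      Relation.EqvGen (ValueStep F f) (canon F a) (canon F b) := fun a b =>
    ⟨fun h => Quot.eqvGen_exact (hι (e.injective h)),
      fun h => congrArg (fun q => e (ι q)) (Quot.eqvGen_sound h)⟩
  have htot : ∀ {a b : ℕ × R}, Relation.EqvGen (ValueStep F f) a b → a.1 < b.1 →
      Relation.ReflTransGen (ValueStep F f) a b := by
    intro a b h hab
    refine (reflTransGen_or_of_eqvGen hF.valueStep_right_unique
      (hF.valueStep_left_unique hf) h).resolve_right fun h' => ?_
    have := le_of_reflTransGen_valueStep hf h'
    omega
  have hgen : ∀ {a b : ℕ × R}, Relation.ReflTransGen (ValueStep F f) a b →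
      Relation.EqvGen (ValueStep F f) a b := by
    intro a b h
    induction h with
    | refl => exact .refl _
    | tail _ h ih => exact ih.trans _ _ _ (.rel _ _ h)
  refine ⟨σ, hF.realized_of ?_ ?_⟩
  · have main : ∀ a b : ℕ × R, a.1 ≤ b.1 → b.1 ≤ a.1 + r →
        (Linked F a b ↔ σ a.1 a.2 = σ b.1 b.2) := by
      intro a b h1 h2
      rw [hσ, ← hF.linked_canon_canon h1 h2]
      constructor
      · intro h
        exact hgen (Relation.ReflTransGen.mono (fun _ _ => Or.inl) _ _
          (hF.reflTransGen_of_linked (hF.canon_canon a) (hF.canon_canon b) h1 h))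
      · intro h
        rcases reflTransGen_or_of_eqvGen hF.valueStep_right_unique
          (hF.valueStep_left_unique hf) h with h | h
        · exact hF.linked_of_reflTransGen hf h h2
        · exact hF.linked_symm (hF.linked_of_reflTransGen hf h (by simp only [canon_fst]; omega))
    intro a b h1 h2
    rcases le_total a.1 b.1 with h | h
    · exact main a b h h2
    · rw [eq_comm, ← main b a h h1]
      exact ⟨hF.linked_symm, hF.linked_symm⟩
  · intro a z
    rw [← hF.due_canon]
    constructor
    · intro h
      obtain ⟨b, h1, h2, h3⟩ := hF.exists_reflTransGen_of_due hf hpend (hF.canon_canon a) h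
      refine ⟨b.1, h2, (hσ a (b.1, z)).2 ?_⟩
      have hb : canon F b = b := by
        rcases Relation.ReflTransGen.cases_tail h1 with h | ⟨c, -, hc⟩
        · rw [h, hF.canon_canon]
        · exact hc.canon_right hf
      rw [← hF.canon_congr (a := b) (b := (b.1, z)) rfl h3, hb]
      exact hgen h1
    · rintro ⟨m, hm, h⟩
      have h1 := htot ((hσ a (m, z)).1 h) hm
      rcases Relation.ReflTransGen.cases_head h1 with e | ⟨c, hc, hcb⟩
      · have : a.1 = m := congrArg Prod.fst e
        omega
      · exact (hF.due_iff_of_valueStep hf hc z).2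
          (hF.occurs_or_due_of_reflTransGen hf hcb (hF.linked_symm (hF.linked_canon (m, z))))

end ValueStep

end Occurrences

/-! ## Existence of continuations -/

section Continuation

variable {R : Type} {r : ℕ} {F : ℕ → Set (RemoteConstraint R r)}

theorem exists_seq_frequently_eq {α : Type*} [Countable α] {Y : Set α} (hY : Y.Nonempty) :
    ∃ e : ℕ → α, ∀ z ∈ Y, ∀ N, ∃ k, N ≤ k ∧ e k = z := by
  have : Nonempty Y := hY.to_subtype
  obtain ⟨g, hg⟩ := exists_surjective_nat Y
  refine ⟨fun k => g (Nat.unpair k).1, fun z hz N => ?_⟩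
  obtain ⟨i, hi⟩ := hg ⟨z, hz⟩
  exact ⟨Nat.pair i N, Nat.right_le_pair i N, by simp [hi]⟩

/-- Backwards a thread is deterministic, so one of the two starts would be reached from the other;
but a start has no predecessor. -/
theorem IsThreadStart.eq_of_reflTransGen (hF : IsRemoteModel F) {Y : Set R} {a b c : ℕ × R}
    (ha : IsThreadStart F Y a) (hb : IsThreadStart F Y b)
    (h1 : Relation.ReflTransGen (ThreadStep F) a c)
    (h2 : Relation.ReflTransGen (ThreadStep F) b c) : a = b := by
  have key : ∀ {a b : ℕ × R}, IsThreadStart F Y b → Relation.ReflTransGen (ThreadStep F) a b →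
      a = b := by
    intro a b hb h
    rcases Relation.ReflTransGen.cases_tail h with h | ⟨d, -, hd⟩
    · exact h.symm
    · exact (hb.not_linked d hd.lt hd.linked).elim
  rcases Relation.ReflTransGen.total_of_right_unique (r := Function.swap (ThreadStep F))
    (fun a b c h h' => hF.threadStep_left_unique h h') (Relation.ReflTransGen.swap _ _ h1)
    (Relation.ReflTransGen.swap _ _ h2) with h | h
  · exact (key ha (Relation.ReflTransGen.swap _ _ h)).symm
  · exact key hb (Relation.ReflTransGen.swap _ _ h)

/-- The starts are arranged in infinitely many levels: those of level `k` are good for the variable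
`e k`, and every variable of `Y` is listed infinitely often. An end on a thread begun at level `k`
is continued at level `k + 1`, so a chain with infinitely many ends eventually visits every level
and thus a good start for each `z`. -/
theorem IsRemoteModel.exists_isContinuation_of_good [Finite R] (hF : IsRemoteModel F) {Y : Set R}
    (hY : Y.Nonempty)
    (hgood : ∀ z ∈ Y, ∀ N, ∃ a, IsThreadStart F Y a ∧ N < a.1 ∧ Good F Y z a) :
    ∃ f, IsContinuation F Y f := by
  classical
  have : Countable R := Finite.to_countable
  obtain ⟨e, he⟩ := exists_seq_frequently_eq hY
  obtain ⟨ι, hι⟩ := exists_injective_nat R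
  have hpick : ∀ N m : ℕ, ∃ a, IsThreadStart F Y a ∧ N < a.1 ∧
      (e (Nat.unpair m).1 ∈ Y → Good F Y (e (Nat.unpair m).1) a) := by
    intro N m
    by_cases hm : e (Nat.unpair m).1 ∈ Y
    · obtain ⟨a, h1, h2, h3⟩ := hgood _ hm N
      exact ⟨a, h1, h2, fun _ => h3⟩
    · obtain ⟨z, hz⟩ := hY
      obtain ⟨a, h1, h2, h3⟩ := hgood z hz N
      exact ⟨a, h1, h2, fun h => (hm h).elim⟩
  choose pick hp1 hp2 hp3 using hpick
  -- The start with index `pair k c` is number `c` of level `k`. The maximum makes the positions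
  -- strictly increasing, hence `g` injective, and puts `g m` after position `m`.
  let g : ℕ → ℕ × R := fun m => Nat.rec (pick 0 0) (fun m a => pick (max a.1 (m + 1)) (m + 1)) m
  have hg : ∀ m, ∃ N, g m = pick N m ∧ m ≤ N := by
    intro m
    cases m with
    | zero => exact ⟨0, rfl, le_rfl⟩
    | succ m => exact ⟨_, rfl, le_max_right _ _⟩
  have hgstart : ∀ m, IsThreadStart F Y (g m) := by
    intro m; obtain ⟨N, h, -⟩ := hg m; rw [h]; exact hp1 _ _
  have hgpos : ∀ m, m < (g m).1 := by
    intro m; obtain ⟨N, h, h'⟩ := hg m; rw [h]; exact h'.trans_lt (hp2 _ _)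
  have hggood : ∀ m, e (Nat.unpair m).1 ∈ Y → Good F Y (e (Nat.unpair m).1) (g m) := by
    intro m; obtain ⟨N, h, -⟩ := hg m; rw [h]; exact hp3 _ _
  have hginj : Function.Injective g := by
    have : StrictMono fun m => (g m).1 :=
      strictMono_nat_of_lt_succ fun m => (le_max_left _ _).trans_lt (hp2 _ _)
    exact fun a b h => this.injective (congrArg Prod.fst h)
  -- The level on which the thread of `a` is to be continued: one more than the level of its start,
  -- or `0` if its start was not selected.
  let label : ℕ × R → ℕ := fun a =>
    if h : ∃ k c, Relation.ReflTransGen (ThreadStep F) (g (Nat.pair k c)) a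
      then h.choose + 1 else 0
  have hlabel : ∀ k c a, Relation.ReflTransGen (ThreadStep F) (g (Nat.pair k c)) a →
      label a = k + 1 := by
    intro k c a h
    have hex : ∃ k c, Relation.ReflTransGen (ThreadStep F) (g (Nat.pair k c)) a := ⟨k, c, h⟩
    obtain ⟨c', hc'⟩ := hex.choose_spec
    have h1 := hginj ((hgstart _).eq_of_reflTransGen hF (hgstart _) hc' h)
    simp only [label, dif_pos hex]
    rw [(Nat.pair_eq_pair.1 h1).1]
  -- The code makes the continuation injective and, being at least `a.1 + r`, pushes the chosen
  -- start beyond position `a.1 + r`.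
  let code : ℕ × R → ℕ := fun a => Nat.pair (a.1 + r) (ι a.2)
  have hcode : ∀ a, a.1 + r ≤ code a := fun a => Nat.left_le_pair _ _
  have hcodeinj : Function.Injective code := by
    intro a b h
    have h1 := Nat.pair_eq_pair.1 h
    exact Prod.ext (by omega) (hι h1.2)
  refine ⟨fun a => g (Nat.pair (label a) (code a)), fun a _ => hgstart _, fun a _ => ?_,
    fun a b _ _ h => hcodeinj (Nat.pair_eq_pair.1 (hginj h)).2, ?_⟩
  · exact (hcode a).trans_lt ((Nat.right_le_pair _ _).trans_lt (hgpos _))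
  · intro z hz a hstep hinf
    have hrun : ∀ k, ∃ k', k ≤ k' ∧ Relation.ReflTransGen (ThreadStep F) (a k) (a k') ∧
        a (k' + 1) = g (Nat.pair (label (a k')) (code (a k'))) := by
      intro k
      have hex : ∃ d, IsThreadEnd F Y (a (k + d)) := by
        obtain ⟨k', hk', h⟩ := hinf k
        exact ⟨k' - k, by rwa [Nat.add_sub_cancel' hk']⟩
      have hmin := fun d (hd : d < Nat.find hex) => Nat.find_min hex hd
      have hfind := Nat.find_spec hex
      refine ⟨k + Nat.find hex, by omega, ?_, ?_⟩
      · have : ∀ d, d ≤ Nat.find hex → Relation.ReflTransGen (ThreadStep F) (a k) (a (k + d)) := by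
          intro d
          induction d with
          | zero => exact fun _ => .refl
          | succ d ih =>
            intro hd
            exact (ih (by omega)).tail ((hstep (k + d)).resolve_right fun h => hmin d hd h.1)
        exact this _ le_rfl
      · rcases hstep (k + Nat.find hex) with h | h
        · exact (hfind.not_linked _ h.lt h.linked).elim
        · exact h.2
    -- After the first jump the chain is on a selected start, and each further jump raises the level
    -- by exactly one.
    have hall : ∃ k₀, ∀ j, ∃ k c, a k = g (Nat.pair (k₀ + j) c) := by
      obtain ⟨k', -, -, h⟩ := hrun 0
      refine ⟨label (a k'), fun j => ?_⟩
      induction j with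
      | zero => exact ⟨_, _, h⟩
      | succ j ih =>
        obtain ⟨k, c, hk⟩ := ih
        obtain ⟨k', -, h1, h2⟩ := hrun k
        rw [hk] at h1
        rw [hlabel _ _ _ h1] at h2
        exact ⟨_, _, h2⟩
    obtain ⟨k₀, hall⟩ := hall
    obtain ⟨i, hi, hiz⟩ := he z hz k₀
    obtain ⟨k, c, hk⟩ := hall (i - k₀)
    rw [Nat.add_sub_cancel' hi] at hk
    refine ⟨k, ?_⟩
    have := hggood (Nat.pair i c)
    simp only [Nat.unpair_pair, hiz] at this
    rw [hk]
    exact this hz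

/-- Hall's theorem. The sets of admissible starts are nested, so for a set of ends its earliest
member alone provides enough starts. Fairness is vacuous because no end lies at or after `N`. -/
theorem exists_isContinuation_of_count [Finite R] {Y : Set R} (N : ℕ)
    (hbound : ∀ a, IsThreadEnd F Y a → a.1 < N)
    (hcount : ∀ p, {a | IsThreadEnd F Y a ∧ p ≤ a.1}.ncard ≤
      {a | IsThreadStart F Y a ∧ p + r < a.1 ∧ a.1 < N + r}.ncard) :
    ∃ f, IsContinuation F Y f := by
  classical
  have hfin : ∀ (M : ℕ) (S : Set (ℕ × R)), (∀ a ∈ S, a.1 < M) → S.Finite := fun M S h =>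
    ((Set.finite_Iio M).prod Set.finite_univ).subset fun a ha => ⟨h a ha, Set.mem_univ _⟩
  have hS : ∀ p, {a | IsThreadStart F Y a ∧ p + r < a.1 ∧ a.1 < N + r}.Finite := fun p =>
    hfin (N + r) _ fun a h => h.2.2
  have hE : ∀ p, {a | IsThreadEnd F Y a ∧ p ≤ a.1}.Finite := fun p =>
    hfin N _ fun a h => hbound a h.1
  let t : {a // IsThreadEnd F Y a} → Finset (ℕ × R) := fun a => (hS a.1.1).toFinset
  obtain ⟨f, hf, hft⟩ := (Finset.all_card_le_biUnion_card_iff_exists_injective t).1 (by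
    intro s
    rcases s.eq_empty_or_nonempty with rfl | hs
    · simp
    obtain ⟨a₀, ha₀, hmin⟩ := s.exists_min_image (fun a => a.1.1) hs
    calc s.card = (s.map (Function.Embedding.subtype _)).card := (Finset.card_map _).symm
      _ ≤ (hE a₀.1.1).toFinset.card := by
        refine Finset.card_le_card fun a ha => ?_
        obtain ⟨b, hb, rfl⟩ := Finset.mem_map.1 ha
        exact (Set.Finite.mem_toFinset _).2 ⟨b.2, hmin b hb⟩
      _ ≤ (t a₀).card := by
        have := hcount a₀.1.1
        rwa [Set.ncard_eq_toFinset_card _ (hE _), Set.ncard_eq_toFinset_card _ (hS _)] at this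
      _ ≤ (s.biUnion t).card := Finset.card_le_card (Finset.subset_biUnion_of_mem t ha₀))
  have hft' := fun a => (Set.Finite.mem_toFinset _).1 (hft a)
  refine ⟨fun a => if h : IsThreadEnd F Y a then f ⟨a, h⟩ else a, ?_, ?_, ?_, ?_⟩
  · intro a h
    rw [dif_pos h]
    exact (hft' ⟨a, h⟩).1
  · intro a h
    rw [dif_pos h]
    exact (hft' ⟨a, h⟩).2.1
  · intro a b ha hb h
    rw [dif_pos ha, dif_pos hb] at h
    exact congrArg Subtype.val (hf h)
  · intro z _ a hstep hinf
    exfalso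
    have hlt : ∀ k, (a k).1 < (a (k + 1)).1 := by
      intro k
      rcases hstep k with h | ⟨h, e⟩
      · exact h.lt
      · rw [e, dif_pos h]
        exact (Nat.le_add_right _ r).trans_lt (hft' ⟨a k, h⟩).2.1
    obtain ⟨k, hk, h⟩ := hinf N
    exact absurd (hk.trans ((strictMono_nat_of_lt_succ hlt).le_apply)) (not_le.2 (hbound _ h))

/-! ### Frame points as ends and starts of threads. -/

theorem IsRemoteModel.mem_nowSet (hF : IsRemoteModel F) {n : ℕ} {i : Fin (r + 1)} {x y : R} :
    y ∈ nowSet (F n) i x ↔ Linked F (n + i, x) (n + i, y) :=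
  (hF.linked_iff n i i x y).symm

theorem IsRemoteModel.mem_xfSet (hF : IsRemoteModel F) {n : ℕ} {i : Fin (r + 1)} {x y : R} :
    y ∈ xfSet (F n) i x ↔ Due F (n + i, x) y :=
  (hF.due_iff n i x y).symm

theorem IsRemoteModel.nowSet_eq_iff (hF : IsRemoteModel F) {n : ℕ} {i : Fin (r + 1)} {x y : R} :
    nowSet (F n) i x = nowSet (F n) i y ↔ canon F (n + i, x) = canon F (n + i, y) := by
  constructor
  · intro h
    refine hF.canon_congr rfl (hF.mem_nowSet.1 ?_)
    rw [h]
    exact hF.mem_nowSet.2 (hF.linked_refl _)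
  · intro h
    have hxy : Linked F (n + i, x) (n + i, y) := by
      have h1 := hF.linked_canon (n + i, x)
      rw [h] at h1
      exact hF.linked_trans (n + i) le_rfl (by simp [canon_fst]) le_rfl (by simp) (by simp [canon_fst])
        (by simp) h1 (hF.linked_symm (hF.linked_canon _))
    ext w
    rw [hF.mem_nowSet, hF.mem_nowSet]
    constructor
    · exact hF.linked_trans (n + i) le_rfl le_rfl le_rfl (by simp) (by simp) (by simp)
        (hF.linked_symm hxy)
    · exact hF.linked_trans (n + i) le_rfl le_rfl le_rfl (by simp) (by simp) (by simp) hxy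

theorem IsRemoteModel.isThreadEnd_canon (hF : IsRemoteModel F) {Y : Set R} {n : ℕ} {x : R} :
    IsThreadEnd F Y (canon F (n, x)) ↔
      (∀ (j : Fin (r + 1)) y, 0 < j → .eq 0 x j y ∉ F n) ∧ xfSet (F n) 0 x = Y := by
  have hx : {z | Due F (canon F (n, x)) z} = xfSet (F n) 0 x := by
    ext z
    exact hF.due_canon (n, x) z
  have hl : ∀ b : ℕ × R, n < b.1 → (Linked F (canon F (n, x)) b ↔ Linked F (n, x) b) := by
    intro b hb
    have h1 := hF.linked_canon (n, x)
    constructor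
    · intro h
      exact hF.linked_trans n le_rfl (by simp [canon_fst]) hb.le (by simp) (by simp [canon_fst])
        h.dist.2 h1 h
    · intro h
      exact hF.linked_trans n (by simp [canon_fst]) le_rfl hb.le (by simp [canon_fst]) (by simp)
        h.dist.2 (hF.linked_symm h1) h
  constructor
  · rintro ⟨-, h1, h2⟩
    refine ⟨fun j y hj h => ?_, hx ▸ h2⟩
    have hlt : n < n + (j : ℕ) := by
      rw [Fin.lt_def, Fin.val_zero] at hj
      omega
    exact h1 (n + j, y) hlt ((hl _ hlt).2 ((hF.linked_iff n 0 j x y).2 h))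
  · rintro ⟨h1, h2⟩
    refine ⟨hF.canon_canon _, fun b hb h => ?_, hx.trans h2⟩
    have h3 := (hl b hb).1 h
    have h4 := h3.dist.2
    rw [canon_fst] at hb
    rw [hF.linked_iff_mem le_rfl hb.le (by simp) h4] at h3
    refine h1 ⟨b.1 - n, by dsimp only at h4 hb; omega⟩ b.2 ?_ ?_
    · rw [Fin.lt_def]; dsimp at hb ⊢; omega
    · convert h3 using 2; ext; simp

theorem IsRemoteModel.isThreadStart_canon (hF : IsRemoteModel F) {Y : Set R} {n : ℕ} {x : R} :
    IsThreadStart F Y (canon F (n + r, x)) ↔ IsStart (F n) Y x := by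
  have hc := hF.linked_canon (n + r, x)
  have hx : {z | Linked F (canon F (n + r, x)) ((canon F (n + r, x)).1, z) ∨
      Due F (canon F (n + r, x)) z} = nowSet (F n) (Fin.last r) x ∪ xfSet (F n) (Fin.last r) x := by
    ext z
    rw [Set.mem_union, hF.mem_nowSet, hF.mem_xfSet, Set.mem_ofPred_eq, hF.due_canon, canon_fst]
    refine or_congr_left ⟨fun h => ?_, fun h => ?_⟩
    · exact hF.linked_trans (n + r) le_rfl (by simp [canon_fst]) le_rfl (by simp) (by simp [canon_fst])
        (by simp) hc h
    · exact hF.linked_trans (n + r) (by simp [canon_fst]) le_rfl le_rfl (by simp [canon_fst]) (by simp)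
        (by simp) (hF.linked_symm hc) h
  have hl : ∀ b : ℕ × R, b.1 < n + r →
      (Linked F b (canon F (n + r, x)) ↔ Linked F b (n + r, x)) := by
    intro b hb
    constructor
    · intro h
      exact hF.linked_trans b.1 le_rfl hb.le hb.le (by simp) h.dist.2 h.dist.2 h
        (hF.linked_symm hc)
    · intro h
      exact hF.linked_trans b.1 le_rfl hb.le hb.le (by simp) h.dist.2 h.dist.2 h hc
  constructor
  · rintro ⟨-, h1, h2⟩
    refine ⟨fun i y hi h => ?_, hx ▸ h2⟩
    have hlt : n + (i : ℕ) < n + r := by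
      rw [Fin.lt_def, Fin.val_last] at hi
      omega
    exact h1 (n + i, y) hlt ((hl _ hlt).2 ((hF.linked_iff n i (Fin.last r) y x).2 h))
  · rintro ⟨h1, h2⟩
    refine ⟨hF.canon_canon _, fun b hb h => ?_, hx.trans h2⟩
    have h3 := (hl b hb).1 h
    have h4 := h3.dist.2
    rw [canon_fst] at hb
    dsimp only at h4 hb
    rw [hF.linked_iff_mem (k := n) (by omega) (by simp) (by omega) (by simp)] at h3
    refine h1 ⟨b.1 - n, by omega⟩ b.2 ?_ ?_
    · rw [Fin.lt_def, Fin.val_last]; dsimp; omega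
    · convert h3 using 2; ext; simp

/-- Classes at level `0` correspond to canonical occurrences at position `n`. Points of decrement
are treated alike at level `r`, that is at position `n + r`. -/
theorem IsRemoteModel.ncard_incPoints (hF : IsRemoteModel F) (Y : Set R) (n : ℕ) :
    (incPoints (F n) Y).ncard = {a | IsThreadEnd F Y a ∧ a.1 = n}.ncard := by
  have : incPoints (F n) Y = (fun a => nowSet (F n) 0 a.2) '' {a | IsThreadEnd F Y a ∧ a.1 = n} := by
    ext C
    constructor
    · rintro ⟨x, rfl, h⟩
      refine ⟨canon F (n, x), ⟨hF.isThreadEnd_canon.2 h, rfl⟩, ?_⟩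
      exact (hF.nowSet_eq_iff (i := 0)).2 (hF.canon_canon (n, x))
    · rintro ⟨⟨_, x⟩, ⟨h, rfl⟩, rfl⟩
      refine ⟨x, rfl, hF.isThreadEnd_canon.1 ?_⟩
      rwa [h.canon_eq]
  rw [this, Set.InjOn.ncard_image]
  rintro ⟨_, x⟩ ⟨hx, rfl⟩ ⟨m, y⟩ ⟨hy, h⟩ hxy
  dsimp only at h
  subst h
  rw [← hx.canon_eq, ← hy.canon_eq]
  exact (hF.nowSet_eq_iff (i := 0)).1 hxy

theorem IsRemoteModel.ncard_decPoints (hF : IsRemoteModel F) (Y : Set R) (n : ℕ) :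
    (decPoints (F n) Y).ncard = {a | IsThreadStart F Y a ∧ a.1 = n + r}.ncard := by
  have : decPoints (F n) Y =
      (fun a => nowSet (F n) (Fin.last r) a.2) '' {a | IsThreadStart F Y a ∧ a.1 = n + r} := by
    ext C
    constructor
    · rintro ⟨x, rfl, h⟩
      refine ⟨canon F (n + r, x), ⟨hF.isThreadStart_canon.2 h, rfl⟩, ?_⟩
      exact (hF.nowSet_eq_iff (i := Fin.last r)).2 (hF.canon_canon (n + r, x))
    · rintro ⟨⟨m, x⟩, ⟨h, h'⟩, rfl⟩
      dsimp only at h'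
      subst h'
      refine ⟨x, rfl, hF.isThreadStart_canon.1 ?_⟩
      rwa [h.canon_eq]
  rw [this, Set.InjOn.ncard_image]
  rintro ⟨m, x⟩ ⟨hx, h'⟩ ⟨m', y⟩ ⟨hy, h⟩ hxy
  dsimp only at h h'
  subst h h'
  rw [← hx.canon_eq, ← hy.canon_eq]
  exact (hF.nowSet_eq_iff (i := Fin.last r)).1 hxy

/-- A counter that returns to zero yields a continuation. -/
theorem IsRemoteModel.exists_isContinuation_of_counter [Finite R] (hF : IsRemoteModel F) {Y : Set R}
    (N : ℕ) (v d : ℕ → ℕ) (hd : ∀ n, d n ≤ (decPoints (F n) Y).ncard)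
    (hv : ∀ n, v (n + 2) + d (n + 1) = v (n + 1) + (incPoints (F n) Y).ncard)
    (hN : v (N + 1) = 0) (hinc : ∀ n, N ≤ n → (incPoints (F n) Y).ncard = 0) :
    ∃ f, IsContinuation F Y f := by
  have hfin : ∀ (M : ℕ) (S : Set (ℕ × R)), (∀ a ∈ S, a.1 < M) → S.Finite := fun M S h =>
    ((Set.finite_Iio M).prod Set.finite_univ).subset fun a ha => ⟨h a ha, Set.mem_univ _⟩
  have hbound : ∀ a, IsThreadEnd F Y a → a.1 < N := by
    intro a ha
    by_contra hlt
    have h1 := hinc a.1 (not_lt.1 hlt)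
    rw [hF.ncard_incPoints, Set.ncard_eq_zero (hfin (a.1 + 1) _ fun b hb => by
      have := hb.2
      omega)] at h1
    exact (Set.eq_empty_iff_forall_notMem.1 h1 a) ⟨ha, rfl⟩
  have hA : ∀ p, {a | IsThreadEnd F Y a ∧ p ≤ a.1}.ncard =
      (incPoints (F p) Y).ncard + {a | IsThreadEnd F Y a ∧ p + 1 ≤ a.1}.ncard := by
    intro p
    rw [hF.ncard_incPoints, ← Set.ncard_union_eq ?_ (hfin N _ fun a h => hbound a h.1)
      (hfin N _ fun a h => hbound a h.1)]
    · congr 1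
      ext a
      simp only [Set.mem_ofPred_eq, Set.mem_union, ← and_or_left]
      exact and_congr_right fun _ => by omega
    · rw [Set.disjoint_left]
      rintro a ⟨-, h1⟩ ⟨-, h2⟩
      omega
  have hB : ∀ p, p + 1 ≤ N → {a | IsThreadStart F Y a ∧ p + r < a.1 ∧ a.1 < N + 1 + r}.ncard =
      (decPoints (F (p + 1)) Y).ncard +
        {a | IsThreadStart F Y a ∧ p + 1 + r < a.1 ∧ a.1 < N + 1 + r}.ncard := by
    intro p hp
    rw [hF.ncard_decPoints, ← Set.ncard_union_eq ?_
      (hfin (p + 1 + r + 1) _ fun a h => by have := h.2; omega)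
      (hfin (N + 1 + r) _ fun a h => h.2.2)]
    · congr 1
      ext a
      simp only [Set.mem_ofPred_eq, Set.mem_union, ← and_or_left]
      exact and_congr_right fun _ => by omega
    · rw [Set.disjoint_left]
      rintro a ⟨-, h1⟩ ⟨-, h2, -⟩
      omega
  have hzero : ∀ p, N ≤ p → {a | IsThreadEnd F Y a ∧ p ≤ a.1}.ncard = 0 := by
    intro p hp
    rw [Set.ncard_eq_zero (hfin N _ fun a h => hbound a h.1), Set.eq_empty_iff_forall_notMem]
    rintro a ⟨h1, h2⟩
    have := hbound a h1
    omega
  -- Backward induction from `N`: what the counter holds, together with the ends still to come, must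
  -- be consumed by later starts before it reaches zero. Ends at `p` count only from frame `p + 1`
  -- on, whose starts lie at `p + 1 + r`; this delay yields the distance required of a continuation.
  have hmain : ∀ k p, p + k = N → v (p + 1) + {a | IsThreadEnd F Y a ∧ p ≤ a.1}.ncard ≤
      {a | IsThreadStart F Y a ∧ p + r < a.1 ∧ a.1 < N + 1 + r}.ncard := by
    intro k
    induction k with
    | zero =>
      rintro p rfl
      rw [hzero _ (by omega)]
      simp only [Nat.add_zero] at hN
      omega
    | succ k ih =>
      intro p hp
      have h1 := ih (p + 1) (by omega)
      have h2 := hv p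
      have h3 := hd (p + 1)
      rw [hA, hB p (by omega)]
      simp only [show p + 1 + 1 = p + 2 from rfl] at h1
      omega
  refine exists_isContinuation_of_count (N + 1) (fun a h => (hbound a h).trans (by omega))
    fun p => ?_
  by_cases hp : p ≤ N
  · have := hmain (N - p) p (by omega)
    omega
  · rw [hzero p (by omega)]
    exact Nat.zero_le _

end Continuation

/-! ## Accepted words are realizable -/

section Soundness

variable {R : Type} {r : ℕ} {F : ℕ → Set (RemoteConstraint R r)}

theorem IsRemoteModel.reflTransGen_of_follow (hF : IsRemoteModel F) {n : ℕ} {c d : Cell R r}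
    (h : Follow (F n) c d) : Relation.ReflTransGen (ThreadStep F) (canon F (n + c.1, c.2))
      (canon F (n + 1 + d.1, d.2)) := by
  obtain ⟨i, x⟩ := c
  obtain ⟨j, y⟩ := d
  rcases h with ⟨h1, h2⟩ | ⟨h1, k, h2, h3⟩
  · dsimp only at h1 h2 ⊢
    rw [h1, h2, show n + (j + 1 : ℕ) = n + 1 + j by omega]
  · dsimp only at h1 h2 h3 ⊢
    subst h1
    rw [show n + 1 + (j : ℕ) = n + k by omega]
    exact hF.reflTransGen_canon (by simp) ((hF.linked_iff n 0 k x y).2 h3)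

/-- Tracking can begin only at a start of type `Y` and can be given up only at a cell witnessing
that the thread is good. Were the start not good, the tracker would never become nothing again. -/
theorem IsRemoteModel.exists_good_of_track (hF : IsRemoteModel F) {Y : Set R} {z : R}
    {t : ℕ → Option (Cell R r)}
    (hnone : ∀ n, t n = none →
      t (n + 1) = none ∨ ∃ x, IsStart (F n) Y x ∧ t (n + 1) = some (Fin.last r, x))
    (hsome : ∀ n c, t (n + 1) = some c →
      ((z ∈ nowSet (F n) c.1 c.2 ∨ xfSet (F n) c.1 c.2 ≠ Y) ∧ t (n + 2) = none) ∨
      ∃ d, Follow (F n) c d ∧ t (n + 2) = some d)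
    (hinf : ∀ N, ∃ n, N ≤ n ∧ t n = none) (hinf' : ∀ N, ∃ n, N ≤ n ∧ t n ≠ none) (N : ℕ) :
    ∃ a, IsThreadStart F Y a ∧ N < a.1 ∧ Good F Y z a := by
  classical
  obtain ⟨n₀, hn₀, h₀⟩ := hinf (N + 1)
  obtain ⟨n, x, hn, hx, ht⟩ : ∃ n x, n₀ ≤ n ∧ IsStart (F n) Y x ∧
      t (n + 1) = some (Fin.last r, x) := by
    obtain ⟨n₁, hn₁, h₁⟩ := hinf' n₀
    by_contra hcon
    push Not at hcon
    have : ∀ k, t (n₀ + k) = none := by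
      intro k
      induction k with
      | zero => exact h₀
      | succ k ih =>
        refine (hnone _ ih).resolve_right ?_
        rintro ⟨x, hx, h⟩
        exact hcon (n₀ + k) x (by omega) hx h
    apply h₁
    rw [← Nat.add_sub_cancel' hn₁]
    exact this _
  refine ⟨canon F (n + r, x), hF.isThreadStart_canon.2 hx, by rw [canon_fst]; dsimp; omega, ?_⟩
  by_contra hgood
  have hall : ∀ k, ∃ c, t (n + k + 1) = some c ∧ Relation.ReflTransGen (ThreadStep F)
      (canon F (n + r, x)) (canon F (n + k + c.1, c.2)) := by
    intro k
    induction k with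
    | zero => exact ⟨_, ht, .refl⟩
    | succ k ih =>
      obtain ⟨c, hc, hreach⟩ := ih
      rcases hsome _ c hc with ⟨h, -⟩ | ⟨d, hd, htd⟩
      · refine (hgood ⟨_, hreach, h.imp (fun h => ?_) fun h e => h ?_⟩).elim
        · exact hF.linked_trans (n + k + c.1) (by simp [canon_fst]) le_rfl le_rfl (by simp [canon_fst])
            (by simp) (by simp [canon_fst]) (hF.linked_symm (hF.linked_canon _)) (hF.mem_nowSet.1 h)
        · rw [← e]
          ext w
          rw [hF.mem_xfSet, Set.mem_ofPred_eq, hF.due_canon]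
      · exact ⟨d, htd, hreach.trans (hF.reflTransGen_of_follow hd)⟩
  obtain ⟨m, hm, h⟩ := hinf (n + 1)
  obtain ⟨c, hc, -⟩ := hall (m - (n + 1))
  rw [show n + (m - (n + 1)) + 1 = m by omega, h] at hc
  cases hc

/-- On an infinite thread where `z` is due and never met, every reload picks up a cell of the
thread, and following it never drops the thread. So the set could not become empty again. -/
theorem IsRemoteModel.exists_linked_of_pend (hF : IsRemoteModel F) {z : R}
    {B : ℕ → Set (Cell R r)}
    (hreload : ∀ n, B n = ∅ → B (n + 1) = {c | .xf c.1 c.2 z ∈ F n})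
    (hfollow : ∀ n, B (n + 1) ≠ ∅ → B (n + 2) =
      {d | ∃ c ∈ B (n + 1), (∀ j, c.1 < j → .eq c.1 c.2 j z ∉ F n) ∧ Follow (F n) c d})
    (hinf : ∀ N, ∃ n, N ≤ n ∧ B n = ∅) (a : ℕ → ℕ × R)
    (ha : ∀ k, ThreadStep F (a k) (a (k + 1))) (hz : Due F (a 0) z) :
    ∃ k, Linked F (a (k + 1)) ((a (k + 1)).1, z) := by
  classical
  by_contra hcon
  push Not at hcon
  have hdue : ∀ k, Due F (a k) z := by
    intro k
    induction k with
    | zero => exact hz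
    | succ k ih => exact ((hF.due_iff_of_threadStep (ha k) z).1 ih).resolve_left (hcon k)
  have hmono : StrictMono fun k => (a k).1 := strictMono_nat_of_lt_succ fun k => (ha k).lt
  have hchain : ∀ k b, Relation.ReflTransGen (ThreadStep F) (a k) b → ∃ j, k ≤ j ∧ b = a j := by
    intro k b hb
    induction hb with
    | refl => exact ⟨k, le_rfl, rfl⟩
    | tail _ h ih =>
      obtain ⟨j, hj, rfl⟩ := ih
      exact ⟨j + 1, by omega, hF.threadStep_right_unique h (ha j)⟩
  obtain ⟨n, hn, hBn⟩ := hinf ((a 0).1 + 1)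
  have hall : ∀ t, ∃ k, ∃ i : Fin (r + 1), (a (k + 1)).1 = n + t + i ∧
      (i, (a (k + 1)).2) ∈ B (n + t + 1) := by
    intro t
    induction t with
    | zero =>
      -- The first member of the thread at or after `n` lies inside the window of frame `n`, since
      -- its predecessor lies before `n` and at distance at most `r`.
      have hex : ∃ k, n ≤ (a k).1 := ⟨n, hmono.le_apply⟩
      have h1 := Nat.find_spec hex
      cases hk : Nat.find hex with
      | zero =>
        rw [hk] at h1
        omega
      | succ k =>
        rw [hk] at h1
        have h2 := Nat.find_min hex (m := k) (by omega)
        have h3 := (ha k).linked.dist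
        have h4 : (a (k + 1)).1 = n + ((a (k + 1)).1 - n) := by omega
        refine ⟨k, ⟨(a (k + 1)).1 - n, by omega⟩, h4, ?_⟩
        change _ ∈ B (n + 1)
        rw [hreload n hBn, Set.mem_ofPred_eq, ← hF.due_iff]
        dsimp only
        rw [← h4]
        exact hdue _
    | succ t ih =>
      obtain ⟨k, i, hi, hmem⟩ := ih
      have hne : B (n + t + 1) ≠ ∅ := Set.nonempty_iff_ne_empty.1 ⟨_, hmem⟩
      have hB : B (n + (t + 1) + 1) = _ := hfollow (n + t) hne
      have hmiss : ∀ j, i < j → .eq i (a (k + 1)).2 j z ∉ F (n + t) := by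
        intro j hij h
        rw [Fin.lt_def] at hij
        rw [← hF.linked_iff, ← hi] at h
        have h1 := hF.reflTransGen_canon (by dsimp; omega) h
        rw [(ha k).canon_right] at h1
        obtain ⟨m, hm, e⟩ := hchain _ _ h1
        obtain ⟨m, rfl⟩ := Nat.exists_eq_add_of_le' (show 1 ≤ m by omega)
        refine hcon m ?_
        rw [← e]
        exact hF.linked_symm (hF.linked_canon (n + t + (j : ℕ), z))
      have h1 := (ha (k + 1)).linked.dist
      have h2 := (ha (k + 1)).lt
      by_cases hi0 : (i : ℕ) = 0
      · refine ⟨k + 1, ⟨(a (k + 1 + 1)).1 - (n + t + 1), by omega⟩, by dsimp only; omega, ?_⟩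
        rw [hB]
        refine ⟨_, hmem, hmiss, Or.inr ⟨Fin.ext hi0,
          ⟨(a (k + 1 + 1)).1 - (n + t), by omega⟩, by dsimp only; omega, ?_⟩⟩
        rw [← hF.linked_iff]
        convert (ha (k + 1)).linked using 1
        · exact Prod.ext (by dsimp; omega) rfl
        · exact Prod.ext (by dsimp; omega) rfl
      · refine ⟨k, ⟨i - 1, by omega⟩, by dsimp only; omega, ?_⟩
        rw [hB]
        exact ⟨_, hmem, hmiss, Or.inl ⟨by dsimp only; omega, rfl⟩⟩
  obtain ⟨m, hm, h⟩ := hinf (n + 1)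
  obtain ⟨k, i, -, hk⟩ := hall (m - (n + 1))
  rw [show n + (m - (n + 1)) + 1 = m by omega, h] at hk
  exact hk

end Soundness

/-! ### From an accepting run to a realization. -/

section

variable {D : Type*} [LT D] {L R : Type} {l r : ℕ}

theorem IsSymbolicModel.isRemoteModel {ρ : ℕ → Frame D L R l r} (h : IsSymbolicModel ρ) :
    IsRemoteModel fun n => remoteProj (ρ n).1 :=
  ⟨fun n => (ρ n).2.2, fun n => (h n).2⟩

theorem RealState.rem_eq {s : RealState D L R l r} {G : Frame D L R l r} (h : s.last = some G) :
    s.rem = remoteProj G.1 := by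
  ext c
  simp [RealState.rem, h]

theorem remoteRealizable_of_mem_language [Infinite D] [Finite L] [Finite R]
    {ρ : ℕ → Frame D L R l r} (h : ρ ∈ (realAutomaton D L R l r).language) :
    IsSymbolicModel ρ ∧ RemoteRealizable ρ := by
  obtain ⟨q, v, u, hrun, Z, ⟨N, hN⟩, hacc⟩ := h
  change ℕ → RealState D L R l r at q
  change Set (RCounter R) at Z
  have ht : ∀ n, RealStep (q n) (ρ n) (u n) (q (n + 1)) := hrun.trans
  have hlast : ∀ n, (q (n + 1)).last = some (ρ n) := fun n => (ht n).last
  have hrem : ∀ n, (q (n + 1)).rem = remoteProj (ρ n).1 := fun n => RealState.rem_eq (hlast n)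
  have hsymb : IsSymbolicModel ρ := fun n => (ht (n + 1)).oneStep _ (hlast n)
  have hF := hsymb.isRemoteModel
  have hpend0 : ∀ N z, ∃ n, N ≤ n ∧ (q n).pend z = ∅ := fun N z =>
    hacc _ (Or.inl ⟨z, rfl⟩) N
  have hcont : ∀ Y : RCounter R, ∃ f, IsContinuation (fun n => remoteProj (ρ n).1) Y.1 f := by
    intro Y
    by_cases hY : Y ∈ Z
    · classical
      have hex : ∃ n, (q n).comp = some Z := ⟨N, hN N le_rfl⟩
      have hin : ∀ n, Nat.find hex ≤ n → (q n).comp = some Z := by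
        intro n hn
        induction n, hn using Nat.le_induction with
        | base => exact Nat.find_spec hex
        | succ n _ ih => exact ((ht n).comp.resolve_left (by simp [ih])).trans ih
      -- The run enters the component on reading frame `m`. The test then gives `v (m + 1) Y = 0`,
      -- and because increments are delayed by one letter, frames from `m` on have no point of
      -- increment for `Y`.
      obtain ⟨m, hm⟩ : ∃ m, Nat.find hex = m + 1 := by
        refine Nat.exists_eq_add_one.2 (Nat.pos_of_ne_zero fun h0 => ?_)
        have h1 := hin 0 h0.le
        rw [show (q 0).comp = none from hrun.init.2.1] at h1
        cases h1
      have hm0 : (q m).comp = none := by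
        refine (ht m).comp.resolve_right fun h1 => Nat.find_min hex (m := m) (by omega) ?_
        rw [← h1]
        exact hin _ hm.le
      have hvm : v (m + 1) Y = 0 := hrun.zero_test m Z hm0 (hin _ hm.le) Y hY
      choose d hd using fun n => (ht n).count
      refine hF.exists_isContinuation_of_counter m (fun n => v n Y) (fun n => d n Y)
        (fun n => (hd n).1 Y) (fun n => ?_) hvm fun n hn => ?_
      · have h1 := hrun.update (n + 1) Y
        have h2 := (hd (n + 1)).2.1 Y
        rw [hrem] at h2
        rw [h2] at h1
        simp only [show n + 1 + 1 = n + 2 from rfl] at h1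
        omega
      · have h1 := ((hd (n + 1)).2.2 Z (hin (n + 1) (by omega)) Y hY).1
        rwa [hrem] at h1
    · refine hF.exists_isContinuation_of_good Y.2 fun z hz => hF.exists_good_of_track
        (t := fun n => (q n).track Y z) (fun n => (ht n).track_none Y z) (fun n c hc => ?_)
        (hacc _ (Or.inr ⟨Y, hY, z, hz, Or.inl rfl⟩)) (hacc _ (Or.inr ⟨Y, hY, z, hz, Or.inr rfl⟩))
      have h1 := (ht (n + 1)).track_some Y z c hc
      rwa [hrem] at h1
  choose f hf using hcont
  refine ⟨hsymb, hF.exists_realization hf fun a z => ?_⟩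
  refine hF.exists_linked_of_pend (B := fun n => (q n).pend z) (fun n => (ht n).pend_reload z)
    (fun n hn => ?_) (fun N => hpend0 N z) a
  have h1 := (ht (n + 1)).pend_follow z hn
  rwa [hrem] at h1

end

/-! ## Realizable symbolic models are accepted -/

section Completeness

variable {D : Type*} {R : Type} {r : ℕ} {σ : ℕ → R → D}

/-- The value `w` occurs at position `m`. -/
def Occurs (σ : ℕ → R → D) (w : D) (m : ℕ) : Prop := ∃ y, σ m y = w

/-- The variables in which `w` occurs at position `n` or later. -/
def varsFrom (σ : ℕ → R → D) (w : D) (n : ℕ) : Set R := {z | ∃ m, n ≤ m ∧ σ m z = w}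

/-- The frame of the constraints that hold at position `n` of the remote model `σ`. -/
def remoteFrameOf (r : ℕ) (σ : ℕ → R → D) (n : ℕ) : Set (RemoteConstraint R r) := {c | c.Sat σ n}

theorem mem_varsFrom_succ {w : D} {n : ℕ} {z : R} :
    z ∈ varsFrom σ w n ↔ σ n z = w ∨ z ∈ varsFrom σ w (n + 1) := by
  constructor
  · rintro ⟨m, hm, h⟩
    rcases hm.eq_or_lt with rfl | hlt
    · exact Or.inl h
    · exact Or.inr ⟨m, hlt, h⟩
  · rintro (h | ⟨m, hm, h⟩)
    · exact ⟨n, le_rfl, h⟩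
    · exact ⟨m, by omega, h⟩

theorem varsFrom_eq_of_not_occurs {w : D} {n m : ℕ} (hnm : n ≤ m)
    (h : ∀ k, n ≤ k → k < m → ¬ Occurs σ w k) : varsFrom σ w n = varsFrom σ w m := by
  ext z
  constructor
  · rintro ⟨k, hk, e⟩
    exact ⟨k, not_lt.1 fun hlt => h k hk hlt ⟨z, e⟩, e⟩
  · rintro ⟨k, hk, e⟩
    exact ⟨k, hnm.trans hk, e⟩

theorem xfSet_remoteFrameOf (n : ℕ) (i : Fin (r + 1)) (x : R) :
    xfSet (remoteFrameOf r σ n) i x = varsFrom σ (σ (n + i) x) (n + i + 1) := by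
  ext z
  exact exists_congr fun m => and_congr_right fun _ => eq_comm

theorem mem_nowSet_remoteFrameOf (n : ℕ) (i : Fin (r + 1)) (x z : R) :
    z ∈ nowSet (remoteFrameOf r σ n) i x ↔ σ (n + i) z = σ (n + i) x :=
  eq_comm

theorem isStart_remoteFrameOf {Y : Set R} {n : ℕ} {x : R} :
    IsStart (remoteFrameOf r σ n) Y x ↔
      (∀ k, n ≤ k → k < n + r → ¬ Occurs σ (σ (n + r) x) k) ∧
        varsFrom σ (σ (n + r) x) (n + r) = Y := by
  refine and_congr ⟨fun h k hk hk' => ?_, fun h i y hi e => ?_⟩ ?_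
  · rintro ⟨y, hy⟩
    refine h ⟨k - n, by omega⟩ y ?_ ?_
    · rw [Fin.lt_def]; dsimp; omega
    · change σ (n + (k - n)) y = σ (n + r) x
      rwa [Nat.add_sub_cancel' hk]
  · rw [Fin.lt_def, Fin.val_last] at hi
    exact h (n + i) (by omega) (by omega) ⟨y, e⟩
  · rw [xfSet_remoteFrameOf]
    have : nowSet (remoteFrameOf r σ n) (Fin.last r) x ∪
        varsFrom σ (σ (n + (Fin.last r : ℕ)) x) (n + (Fin.last r : ℕ) + 1) =
        varsFrom σ (σ (n + r) x) (n + r) := by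
      ext z
      rw [Set.mem_union, mem_nowSet_remoteFrameOf, Fin.val_last]
      exact mem_varsFrom_succ.symm
    rw [this]

/-! ### Counters -/

/-- The values that occurred up to position `n`, do not occur at the next `r` positions, and occur
after position `n` exactly in the variables of `Y`. -/
def waiting (r : ℕ) (σ : ℕ → R → D) (Y : Set R) (n : ℕ) : Set D :=
  {w | (∃ p, p ≤ n ∧ Occurs σ w p) ∧ (∀ k, n < k → k ≤ n + r → ¬ Occurs σ w k) ∧
    varsFrom σ w (n + 1) = Y}

theorem waiting_finite [Finite R] (Y : Set R) (n : ℕ) : (waiting r σ Y n).Finite := by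
  refine (((Set.finite_Iic n).prod (Set.finite_univ (α := R))).image fun a => σ a.1 a.2).subset ?_
  rintro w ⟨⟨p, hp, x, rfl⟩, -⟩
  exact ⟨(p, x), ⟨hp, Set.mem_univ _⟩, rfl⟩

/-- The balance of the counter: the values left after position `n + 1` are the values waiting at `n`
minus those resumed at the start position `n + 1 + r`. Values that occur at the current position
enter only with the next letter. -/
theorem waiting_succ_not_occurs (Y : Set R) (n : ℕ) :
    {w | w ∈ waiting r σ Y (n + 1) ∧ ¬ Occurs σ w (n + 1)} =
      {w | w ∈ waiting r σ Y n ∧ ¬ Occurs σ w (n + 1 + r)} := by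
  ext w
  constructor
  · rintro ⟨⟨⟨p, hp, h1⟩, h2, h3⟩, h4⟩
    refine ⟨⟨⟨p, ?_, h1⟩, fun k hk hk' => ?_, ?_⟩, ?_⟩
    · rcases hp.eq_or_lt with rfl | hlt
      · exact (h4 h1).elim
      · omega
    · rcases Nat.lt_or_ge (n + 1) k with h | h
      · exact h2 k h (by omega)
      · obtain rfl : k = n + 1 := by omega
        exact h4
    · rw [← h3]
      refine varsFrom_eq_of_not_occurs (by omega) fun k hk hk' => ?_
      obtain rfl : k = n + 1 := by omega
      exact h4
    · rcases Nat.eq_zero_or_pos r with h | h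
      · rwa [h, Nat.add_zero]
      · exact h2 _ (by omega) (by omega)
  · rintro ⟨⟨⟨p, hp, h1⟩, h2, h3⟩, h4⟩
    have h5 : ∀ k, n < k → k ≤ n + 1 + r → ¬ Occurs σ w k := by
      intro k hk hk'
      rcases hk'.eq_or_lt with rfl | hlt
      · exact h4
      · exact h2 k hk (by omega)
    refine ⟨⟨⟨p, by omega, h1⟩, fun k hk hk' => h5 k (by omega) hk', ?_⟩, h5 _ (by omega) (by omega)⟩
    rw [← h3]
    refine (varsFrom_eq_of_not_occurs (by omega) fun k hk hk' => h5 k (by omega) (by omega)).symm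

theorem ncard_incPoints_remoteFrameOf (Y : Set R) (n : ℕ) :
    (incPoints (remoteFrameOf r σ n) Y).ncard =
      {w | w ∈ waiting r σ Y n ∧ Occurs σ w n}.ncard := by
  have : incPoints (remoteFrameOf r σ n) Y =
      (fun w => {y | σ n y = w}) '' {w | w ∈ waiting r σ Y n ∧ Occurs σ w n} := by
    ext C
    constructor
    · rintro ⟨x, rfl, h1, h2⟩
      refine ⟨σ n x, ⟨⟨⟨n, le_rfl, x, rfl⟩, fun k hk hk' => ?_, ?_⟩, x, rfl⟩, ?_⟩
      · rintro ⟨y, hy⟩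
        refine h1 ⟨k - n, by omega⟩ y (by rw [Fin.lt_def]; dsimp; omega) ?_
        change σ n x = σ (n + (k - n)) y
        rw [Nat.add_sub_cancel' hk.le, hy]
      · rw [← h2, xfSet_remoteFrameOf]
        rfl
      · ext z
        exact (mem_nowSet_remoteFrameOf n 0 x z).symm
    · rintro ⟨w, ⟨⟨-, h1, h2⟩, x, rfl⟩, rfl⟩
      refine ⟨x, ?_, fun j y hj h => ?_, ?_⟩
      · ext z
        exact (mem_nowSet_remoteFrameOf n 0 x z).symm
      · rw [Fin.lt_def, Fin.val_zero] at hj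
        exact h1 (n + j) (by omega) (by omega) ⟨y, h.symm⟩
      · rw [xfSet_remoteFrameOf]
        exact h2
  rw [this, Set.InjOn.ncard_image]
  rintro w ⟨-, x, rfl⟩ w' ⟨-, y, rfl⟩ h
  exact (Set.ext_iff.1 h x).1 rfl

theorem ncard_waiting_occurs_le [Finite R] (Y : Set R) (n : ℕ) :
    {w | w ∈ waiting r σ Y n ∧ Occurs σ w (n + 1 + r)}.ncard ≤
      (decPoints (remoteFrameOf r σ (n + 1)) Y).ncard := by
  refine Set.ncard_le_ncard_of_injOn (fun w => {y | σ (n + 1 + r) y = w}) ?_ ?_ (Set.toFinite _)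
  · rintro w ⟨⟨-, h1, h2⟩, x, rfl⟩
    refine ⟨x, ?_, isStart_remoteFrameOf.2 ⟨fun k hk hk' => h1 k (by omega) (by omega), ?_⟩⟩
    · ext z
      exact (mem_nowSet_remoteFrameOf (n + 1) (Fin.last r) x z).symm
    · rw [← h2]
      exact (varsFrom_eq_of_not_occurs (by omega) fun k hk hk' => h1 k (by omega) (by omega)).symm
  · rintro w ⟨-, x, rfl⟩ w' ⟨-, y, rfl⟩ h
    exact (Set.ext_iff.1 h x).1 rfl

/-- Without new increments the finite set of waiting values can only shrink. Each member must occur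
again since `Y` is non-empty, and a value still waiting at its occurrence would be a new increment.
-/
theorem waiting_eventually_empty [Finite R] {Y : Set R} (hY : Y.Nonempty) {N : ℕ}
    (hN : ∀ n, N ≤ n → (incPoints (remoteFrameOf r σ n) Y).ncard = 0) :
    ∃ M, ∀ n, M ≤ n → waiting r σ Y n = ∅ := by
  have hno : ∀ n, N ≤ n → ∀ w ∈ waiting r σ Y n, ¬ Occurs σ w n := by
    intro n hn w hw ho
    have h1 := hN n hn
    rw [ncard_incPoints_remoteFrameOf,
      Set.ncard_eq_zero ((waiting_finite Y n).subset fun w h => h.1)] at h1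
    exact Set.eq_empty_iff_forall_notMem.1 h1 w ⟨hw, ho⟩
  have hanti : ∀ n, N ≤ n → waiting r σ Y (n + 1) ⊆ waiting r σ Y n := by
    intro n hn w hw
    have h1 : w ∈ {w | w ∈ waiting r σ Y (n + 1) ∧ ¬ Occurs σ w (n + 1)} :=
      ⟨hw, hno (n + 1) (by omega) w hw⟩
    rw [waiting_succ_not_occurs] at h1
    exact h1.1
  have hanti' : ∀ n m, N ≤ n → n ≤ m → waiting r σ Y m ⊆ waiting r σ Y n := by
    intro n m hn hnm
    induction m, hnm using Nat.le_induction with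
    | base => exact subset_rfl
    | succ m hm ih => exact (hanti m (by omega)).trans ih
  obtain ⟨z, hz⟩ := hY
  have hocc : ∀ w ∈ waiting r σ Y N, ∃ m, N < m ∧ Occurs σ w m := by
    rintro w ⟨-, -, h⟩
    obtain ⟨m, hm, e⟩ : z ∈ varsFrom σ w (N + 1) := h ▸ hz
    exact ⟨m, hm, z, e⟩
  choose! m hm hm' using hocc
  obtain ⟨M, hM⟩ := ((waiting_finite (r := r) (σ := σ) Y N).image m).bddAbove
  refine ⟨max M N, fun n hn => Set.eq_empty_iff_forall_notMem.2 fun w hw => ?_⟩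
  have h1 := hanti' N n le_rfl (by omega) hw
  have h2 : m w ≤ M := hM ⟨w, h1, rfl⟩
  have h3 := hm w h1
  exact hno (m w) (by omega) w (hanti' (m w) n (by omega) (by omega) hw) (hm' w h1)

/-- The values of the counter `Y` along `σ`, and the decrements. -/
theorem exists_counter [Finite R] (r : ℕ) (σ : ℕ → R → D) {Y : Set R} (hY : Y.Nonempty) :
    ∃ v d : ℕ → ℕ, v 0 = 0 ∧ v 1 = 0 ∧ d 0 = 0 ∧
      (∀ n, d n ≤ (decPoints (remoteFrameOf r σ n) Y).ncard) ∧
      (∀ n, v (n + 2) + d (n + 1) = v (n + 1) + (incPoints (remoteFrameOf r σ n) Y).ncard) ∧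
      ((∃ N, ∀ n, N ≤ n → (incPoints (remoteFrameOf r σ n) Y).ncard = 0) →
        ∃ M, ∀ n, M ≤ n → v n = 0 ∧ d n = 0 ∧ (incPoints (remoteFrameOf r σ n) Y).ncard = 0) := by
  have hsplit : ∀ n m, {w | w ∈ waiting r σ Y n ∧ ¬ Occurs σ w m}.ncard +
      {w | w ∈ waiting r σ Y n ∧ Occurs σ w m}.ncard = (waiting r σ Y n).ncard := by
    intro n m
    rw [← Set.ncard_union_eq ?_ ((waiting_finite Y n).subset fun w h => h.1)
      ((waiting_finite Y n).subset fun w h => h.1)]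
    · congr 1
      ext w
      simp only [Set.mem_union, Set.mem_ofPred_eq]
      tauto
    · rw [Set.disjoint_left]
      exact fun w h1 h2 => h1.2 h2.2
  -- After `n + 1` letters the counter holds the values waiting at `n` except those occurring at
  -- `n`, whose increment is still outstanding. All of them are decremented when they return.
  let v : ℕ → ℕ := fun n => Nat.casesOn n 0 fun n =>
    {w | w ∈ waiting r σ Y n ∧ ¬ Occurs σ w n}.ncard
  let d : ℕ → ℕ := fun n => Nat.casesOn n 0 fun n =>
    {w | w ∈ waiting r σ Y n ∧ Occurs σ w (n + 1 + r)}.ncard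
  refine ⟨v, d, rfl, ?_, rfl, ?_, ?_, ?_⟩
  · change Set.ncard _ = 0
    convert Set.ncard_empty D
    rw [Set.eq_empty_iff_forall_notMem]
    rintro w ⟨⟨⟨p, hp, h⟩, -⟩, h'⟩
    obtain rfl : p = 0 := Nat.le_zero.1 hp
    exact h' h
  · intro n
    cases n with
    | zero => exact Nat.zero_le _
    | succ n => exact ncard_waiting_occurs_le Y n
  · intro n
    change Set.ncard {w | w ∈ waiting r σ Y (n + 1) ∧ ¬ Occurs σ w (n + 1)} + Set.ncard _ =
      Set.ncard {w | w ∈ waiting r σ Y n ∧ ¬ Occurs σ w n} + _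
    rw [ncard_incPoints_remoteFrameOf, hsplit, waiting_succ_not_occurs]
    exact hsplit n (n + 1 + r)
  · rintro ⟨N, hN⟩
    obtain ⟨M, hM⟩ := waiting_eventually_empty hY hN
    refine ⟨max N (M + 1), fun n hn => ⟨?_, ?_, hN n (by omega)⟩⟩
    · obtain ⟨n, rfl⟩ := Nat.exists_eq_add_of_le' (show 1 ≤ n by omega)
      change Set.ncard {w | w ∈ waiting r σ Y n ∧ ¬ Occurs σ w n} = 0
      rw [hM n (by omega)]
      simp
    · obtain ⟨n, rfl⟩ := Nat.exists_eq_add_of_le' (show 1 ≤ n by omega)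
      change Set.ncard {w | w ∈ waiting r σ Y n ∧ Occurs σ w (n + 1 + r)} = 0
      rw [hM n (by omega)]
      simp

/-! ### Pending cells -/

/-- The frame read last. -/
def previous (F : ℕ → Set (RemoteConstraint R r)) (n : ℕ) : Set (RemoteConstraint R r) :=
  Nat.casesOn n ∅ F

open Classical in
/-- The pending cells for `z`. -/
noncomputable def pending (F : ℕ → Set (RemoteConstraint R r)) (z : R) : ℕ → Set (Cell R r)
  | 0 => ∅
  | n + 1 => if pending F z n = ∅ then {c | .xf c.1 c.2 z ∈ F n} else
    {d | ∃ c ∈ pending F z n, (∀ j, c.1 < j → .eq c.1 c.2 j z ∉ previous F n) ∧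
      Follow (previous F n) c d}

/-- The finitely many pending cells have a common deadline `M` by which their values occur in `z`.
Following a cell keeps its value and its deadline while its position moves on, so the set is
exhausted by then. -/
theorem pending_frequently_empty [Finite R] (σ : ℕ → R → D) (z : R) (N : ℕ) :
    ∃ n, N ≤ n ∧ pending (remoteFrameOf r σ) z n = ∅ := by
  set B := pending (remoteFrameOf r σ) z with hB
  by_contra hcon
  push Not at hcon
  have hfollow : ∀ n, B (n + 1) ≠ ∅ → B (n + 2) = {d | ∃ c ∈ B (n + 1),
      (∀ j, c.1 < j → .eq c.1 c.2 j z ∉ remoteFrameOf r σ n) ∧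
        Follow (remoteFrameOf r σ n) c d} := fun n hn => if_neg hn
  have hstep : ∀ n M, (∀ c ∈ B (n + 1), ∃ m, n + c.1 < m ∧ m ≤ M ∧ σ (n + c.1) c.2 = σ m z) →
      B (n + 1) ≠ ∅ → ∀ c ∈ B (n + 2), ∃ m, n + 1 + c.1 < m ∧ m ≤ M ∧
        σ (n + 1 + c.1) c.2 = σ m z := by
    intro n M h hne d hd
    rw [hfollow n hne] at hd
    obtain ⟨⟨i, x⟩, hc, hmiss, hd⟩ := hd
    obtain ⟨m, hm, hmM, e⟩ := h _ hc
    dsimp only at hm e hmiss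
    -- The meeting with `z` is not visible in frame `n`, as the cell would have been dropped; hence
    -- it also lies after the followed cell.
    have hmr : n + r < m := by
      by_contra hle
      refine hmiss ⟨m - n, by omega⟩ (by rw [Fin.lt_def]; dsimp; omega) ?_
      change σ (n + i) x = σ (n + (m - n)) z
      rwa [Nat.add_sub_cancel' (by omega)]
    refine ⟨m, ?_, hmM, ?_⟩
    · rcases hd with ⟨h1, -⟩ | ⟨-, j, h1, -⟩
      · dsimp only at h1
        omega
      · omega
    · rw [← e]
      rcases hd with ⟨h1, h2⟩ | ⟨h1, j, h2, h3⟩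
      · dsimp only at h1 h2
        rw [h2, h1]
        congr 1
        omega
      · dsimp only at h1 h3
        subst h1
        change σ (n + (0 : ℕ)) x = σ (n + j) d.2 at h3
        rw [show n + 1 + (d.1 : ℕ) = n + j by omega]
        exact h3.symm
  have hdue : ∀ n, ∀ c ∈ B (n + 1), ∃ m, n + c.1 < m ∧ σ (n + c.1) c.2 = σ m z := by
    intro n
    induction n with
    | zero =>
      intro c hc
      have h0 : B 1 = {c | .xf c.1 c.2 z ∈ remoteFrameOf r σ 0} := if_pos rfl
      rw [h0] at hc
      exact hc
    | succ n ih =>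
      intro c hc
      by_cases hne : B (n + 1) = ∅
      · have h0 : B (n + 2) = {c | .xf c.1 c.2 z ∈ remoteFrameOf r σ (n + 1)} := if_pos hne
        rw [h0] at hc
        exact hc
      · choose! m hm e using ih
        obtain ⟨M, hM⟩ := ((Set.toFinite (B (n + 1))).image m).bddAbove
        obtain ⟨k, h1, -, h2⟩ :=
          hstep n M (fun c hc => ⟨m c, hm c hc, hM ⟨c, hc, rfl⟩, e c hc⟩) hne c hc
        exact ⟨k, h1, h2⟩
  choose! m hm e using hdue N
  obtain ⟨M, hM⟩ := ((Set.toFinite (B (N + 1))).image m).bddAbove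
  have hall : ∀ k, ∀ c ∈ B (N + k + 1), ∃ m, N + k + c.1 < m ∧ m ≤ M ∧
      σ (N + k + c.1) c.2 = σ m z := by
    intro k
    induction k with
    | zero => exact fun c hc => ⟨m c, hm c hc, hM ⟨c, hc, rfl⟩, e c hc⟩
    | succ k ih => exact hstep (N + k) M ih (hcon _ (by omega)).ne_empty
  obtain ⟨c, hc⟩ := hcon (N + M + 1) (by omega)
  obtain ⟨k, h1, h2, -⟩ := hall M c hc
  omega

end Completeness

/-! ### Tracked cells -/

section Tracking

/-- `g` consists of the values of an excursion that begins at `n` and of the last position at which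
it is still under way. -/
structure IsExcursion {C : Type*} (St En : ℕ → C → Prop) (Fo : ℕ → C → C → Prop) (n : ℕ)
    (g : (ℕ → C) × ℕ) : Prop where
  le : n ≤ g.2
  start : St n (g.1 n)
  follow : ∀ k, n ≤ k → k < g.2 → Fo k (g.1 k) (g.1 (k + 1))
  finish : En g.2 (g.1 g.2)

/-- A greedy schedule: when idle, begin any excursion available at the current position, then carry
it out to its end. Since excursions are finite and become available again and again, the tracker is
both idle and busy infinitely often. -/
theorem exists_track {C : Type*} (St En : ℕ → C → Prop) (Fo : ℕ → C → C → Prop) :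
    ∃ t : ℕ → Option C, t 0 = none ∧
      (∀ n, t n = none → t (n + 1) = none ∨ ∃ c, St n c ∧ t (n + 1) = some c) ∧
      (∀ n c, t (n + 1) = some c →
        (En n c ∧ t (n + 2) = none) ∨ ∃ d, Fo n c d ∧ t (n + 2) = some d) ∧
      ((∀ N, ∃ n, N ≤ n ∧ ∃ g, IsExcursion St En Fo n g) →
        (∀ N, ∃ n, N ≤ n ∧ t n = none) ∧ ∀ N, ∃ n, N ≤ n ∧ t n ≠ none) := by
  classical
  have hnext : ∀ (n : ℕ) (o : Option ((ℕ → C) × ℕ)), ∃ o' : Option ((ℕ → C) × ℕ),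
      (o = none → (∀ g, o' = some g → IsExcursion St En Fo n g) ∧
        ((∃ g, IsExcursion St En Fo n g) → o' ≠ none)) ∧
      ∀ g, o = some g → o' = if n ≤ g.2 then some g else none := by
    rintro n (_ | g)
    · by_cases h : ∃ g, IsExcursion St En Fo n g
      · obtain ⟨g, hg⟩ := h
        refine ⟨some g, fun _ => ⟨?_, fun _ => by simp⟩, by simp⟩
        rintro g' e
        rwa [← Option.some.inj e]
      · exact ⟨none, fun _ => ⟨by simp, fun h' => (h h').elim⟩, by simp⟩
    · refine ⟨if n ≤ g.2 then some g else none, by simp, ?_⟩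
      rintro g' e
      rw [Option.some.inj e]
  choose nxt hnxt1 hnxt2 using hnext
  obtain ⟨s, hs0, hs1⟩ : ∃ s : ℕ → Option ((ℕ → C) × ℕ), s 0 = none ∧
      ∀ n, s (n + 1) = nxt n (s n) := ⟨fun n => Nat.rec none nxt n, rfl, fun _ => rfl⟩
  have hstart : ∀ n, s n = none → ∀ g, s (n + 1) = some g → IsExcursion St En Fo n g :=
    fun n h g hg => (hnxt1 n _ h).1 g (hs1 n ▸ hg)
  have hstart' : ∀ n, s n = none → (∃ g, IsExcursion St En Fo n g) → s (n + 1) ≠ none :=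
    fun n h hex => hs1 n ▸ (hnxt1 n _ h).2 hex
  have hkeep : ∀ n g, s n = some g → s (n + 1) = if n ≤ g.2 then some g else none :=
    fun n g h => (hs1 n).trans (hnxt2 n _ g h)
  have hinv : ∀ n g, s (n + 1) = some g → n ≤ g.2 ∧
      (∀ k, n ≤ k → k < g.2 → Fo k (g.1 k) (g.1 (k + 1))) ∧ En g.2 (g.1 g.2) := by
    intro n
    induction n with
    | zero =>
      intro g hg
      have h1 := hstart 0 hs0 g hg
      exact ⟨h1.le, h1.follow, h1.finish⟩
    | succ n ih =>
      intro g hg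
      cases e : s (n + 1) with
      | none =>
        have h1 := hstart _ e g hg
        exact ⟨h1.le, h1.follow, h1.finish⟩
      | some g' =>
        rw [hkeep _ _ e] at hg
        by_cases h : n + 1 ≤ g'.2
        · rw [if_pos h] at hg
          obtain rfl := Option.some.inj hg
          obtain ⟨-, h2, h3⟩ := ih g' e
          exact ⟨h, fun k hk => h2 k (by omega), h3⟩
        · rw [if_neg h] at hg
          cases hg
  -- State `n + 1` refers to frame `n`, hence the excursion is evaluated at `n`.
  obtain ⟨t, ht0, ht1⟩ : ∃ t : ℕ → Option C, t 0 = none ∧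
      ∀ n, t (n + 1) = (s (n + 1)).map fun g => g.1 n :=
    ⟨fun n => Nat.rec none (fun n _ => (s (n + 1)).map fun g => g.1 n) n, rfl, fun _ => rfl⟩
  have htn : ∀ n, t n = none ↔ s n = none := by
    intro n
    cases n with
    | zero => exact ⟨fun _ => hs0, fun _ => ht0⟩
    | succ n => rw [ht1, Option.map_eq_none_iff]
  refine ⟨t, ht0, fun n hn => ?_, fun n c hc => ?_, fun hex => ?_⟩
  · rw [htn] at hn
    cases e : s (n + 1) with
    | none => exact Or.inl ((htn _).2 e)
    | some g =>
      refine Or.inr ⟨_, (hstart n hn g e).start, ?_⟩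
      rw [ht1, e, Option.map_some]
  · rw [ht1, Option.map_eq_some_iff] at hc
    obtain ⟨g, hg, rfl⟩ := hc
    obtain ⟨h1, h2, h3⟩ := hinv n g hg
    have h4 := hkeep _ _ hg
    rcases h1.eq_or_lt with e | hlt
    · refine Or.inl ⟨e ▸ h3, (htn _).2 ?_⟩
      rw [if_neg (by omega)] at h4
      exact h4
    · refine Or.inr ⟨_, h2 n le_rfl hlt, ?_⟩
      rw [if_pos (by omega)] at h4
      exact (ht1 (n + 1)).trans (by rw [h4, Option.map_some])
  · have hnone : ∀ N, ∃ n, N ≤ n ∧ t n = none := by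
      intro N
      cases e : s N with
      | none => exact ⟨N, le_rfl, (htn N).2 e⟩
      | some g =>
        by_contra hcon
        have hcon' : ∀ n, N ≤ n → s n ≠ none := fun n hn h => hcon ⟨n, hn, (htn n).2 h⟩
        have hall : ∀ k, s (N + k) = some g := by
          intro k
          induction k with
          | zero => exact e
          | succ k ih =>
            have h1 := hkeep _ _ ih
            by_cases h : N + k ≤ g.2
            · rwa [if_pos h] at h1
            · rw [if_neg h] at h1
              exact (hcon' (N + k + 1) (by omega) h1).elim
        have h1 := (hinv (N + (g.2 + 1)) g (hall (g.2 + 1 + 1))).1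
        omega
    refine ⟨hnone, fun N => ?_⟩
    obtain ⟨n, hn, h0⟩ := hnone N
    by_contra hcon
    have hcon' : ∀ m, n ≤ m → s m = none := fun m hm => by
      by_contra h
      exact hcon ⟨m, hn.trans hm, fun h' => h ((htn m).1 h')⟩
    obtain ⟨m, hm, hex⟩ := hex n
    exact hstart' m (hcon' m hm) hex (hcon' (m + 1) (by omega))

variable {D : Type*} {R : Type} {r : ℕ} {σ : ℕ → R → D}

/-- A value that waits for `Y` is met in `z`, or ceases to be due in all of `Y`, on a thread of
type `Y`. -/
theorem exists_good_thread {Y : Set R} {z : R} (hz : z ∈ Y) {n : ℕ} {w : D}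
    (hw : w ∈ waiting r σ Y n) (hn : Occurs σ w n) :
    ∃ q m, n + r < q ∧ q ≤ m ∧ Occurs σ w q ∧ Occurs σ w m ∧
      (∀ k, k < q → q ≤ k + r → ¬ Occurs σ w k) ∧ varsFrom σ w q = Y ∧
      (σ m z = w ∨ varsFrom σ w (m + 1) ≠ Y) ∧
      ∀ k, q ≤ k → k < m → ∃ p, k < p ∧ p ≤ k + r ∧ Occurs σ w p := by
  classical
  obtain ⟨-, hno, htype⟩ := hw
  obtain ⟨m', hm', e⟩ : z ∈ varsFrom σ w (n + 1) := htype ▸ hz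
  -- Take the first later occurrence `m` that is good, and then the last thread start `q` up to `m`.
  -- Up to `m` the due set has stayed `Y`, so this thread has type `Y`.
  have hex : ∃ m, n < m ∧ Occurs σ w m ∧ (σ m z = w ∨ varsFrom σ w (m + 1) ≠ Y) :=
    ⟨m', hm', ⟨z, e⟩, Or.inl e⟩
  obtain ⟨m, ⟨hm, hmo, hmg⟩, hmin⟩ : ∃ m, (n < m ∧ Occurs σ w m ∧
      (σ m z = w ∨ varsFrom σ w (m + 1) ≠ Y)) ∧
      ∀ k, k < m → n < k → Occurs σ w k → varsFrom σ w (k + 1) = Y := by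
    refine ⟨Nat.find hex, Nat.find_spec hex, fun k hk h1 h2 => ?_⟩
    by_contra h3
    exact Nat.find_min hex hk ⟨h1, h2, Or.inr h3⟩
  let P : ℕ → Prop := fun q => n < q ∧ Occurs σ w q ∧ ∀ k, k < q → q ≤ k + r → ¬ Occurs σ w k
  have hq0 : ∃ q, q ≤ m ∧ P q := by
    have hex0 : ∃ q, n < q ∧ Occurs σ w q := ⟨m, hm, hmo⟩
    obtain ⟨h1, h2⟩ := Nat.find_spec hex0
    refine ⟨Nat.find hex0, Nat.find_min' hex0 ⟨hm, hmo⟩, h1, h2, fun k hk hk' ho => ?_⟩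
    rcases Nat.lt_or_ge n k with h | h
    · exact Nat.find_min hex0 hk ⟨h, ho⟩
    · exact hno _ h1 (by omega) h2
  obtain ⟨q₀, hq₀, hP₀⟩ := hq0
  obtain ⟨hnq, hqo, hqno⟩ : P (Nat.findGreatest P m) := Nat.findGreatest_spec hq₀ hP₀
  have hqm : Nat.findGreatest P m ≤ m := Nat.findGreatest_le m
  have hgreatest : ∀ p, Nat.findGreatest P m < p → p ≤ m → ¬ P p := fun p =>
    Nat.findGreatest_is_greatest
  generalize Nat.findGreatest P m = q at hnq hqo hqno hqm hgreatest
  refine ⟨q, m, ?_, hqm, hqo, hmo, hqno, ?_, hmg, fun k hk hkm => ?_⟩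
  · by_contra h
    exact hqno n hnq (by omega) hn
  · let Q : ℕ → Prop := fun p => n ≤ p ∧ Occurs σ w p
    have hQ : Q (Nat.findGreatest Q (q - 1)) := Nat.findGreatest_spec (m := n) (by omega) ⟨le_rfl, hn⟩
    have hle : Nat.findGreatest Q (q - 1) ≤ q - 1 := Nat.findGreatest_le _
    have hg : ∀ p, Nat.findGreatest Q (q - 1) < p → p ≤ q - 1 → ¬ Q p := fun p =>
      Nat.findGreatest_is_greatest
    generalize Nat.findGreatest Q (q - 1) = p at hQ hle hg
    rw [← varsFrom_eq_of_not_occurs (n := p + 1) (by omega)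
      fun k hk hk' ho => hg k (by omega) (by omega) ⟨hQ.1.trans (by omega), ho⟩]
    rcases hQ.1.eq_or_lt with rfl | hlt
    · exact htype
    · exact hmin p (by omega) hlt hQ.2
  -- A gap of more than `r` positions after `k` would produce a thread start after `q` and not after
  -- `m`.
  · by_contra hcon
    push Not at hcon
    have hex1 : ∃ p, k < p ∧ Occurs σ w p := ⟨m, hkm, hmo⟩
    obtain ⟨h1, h2⟩ := Nat.find_spec hex1
    have hle : Nat.find hex1 ≤ m := Nat.find_min' hex1 ⟨hkm, hmo⟩
    have hfmin : ∀ j, j < Nat.find hex1 → k < j → ¬ Occurs σ w j := fun j hj hkj ho =>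
      Nat.find_min hex1 hj ⟨hkj, ho⟩
    generalize Nat.find hex1 = p at h1 h2 hle hfmin
    have hkr : k + r < p := by
      by_contra h
      exact hcon p h1 (by omega) h2
    exact hgreatest p (by omega) hle ⟨by omega, h2, fun j hj hj' => hfmin j hj (by omega)⟩

/-- The tracked cell in frame `k` is the next occurrence of `w` at or after `k`. The excursion
begins `r` positions before the thread start, which is then seen at level `r`, and ends in the frame
of the good occurrence. -/
theorem exists_excursion {Y : Set R} {z : R} (hz : z ∈ Y)
    {n₀ : ℕ} {w : D} (hw : w ∈ waiting r σ Y n₀) (hn₀ : Occurs σ w n₀) :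
    ∃ n, n₀ ≤ n ∧ ∃ g, IsExcursion
      (fun n c => ∃ x, IsStart (remoteFrameOf r σ n) Y x ∧ c = (Fin.last r, x))
      (fun n c => z ∈ nowSet (remoteFrameOf r σ n) c.1 c.2 ∨ xfSet (remoteFrameOf r σ n) c.1 c.2 ≠ Y)
      (fun n c d => Follow (remoteFrameOf r σ n) c d) n g := by
  classical
  obtain ⟨q, m, hq, hqm, hqo, hmo, hqno, htype, hgood, hgap⟩ := exists_good_thread hz hw hn₀
  obtain ⟨n, rfl⟩ : ∃ n, q = n + r := ⟨q - r, by omega⟩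
  -- `nx k` is the next occurrence at or after `k`; beyond `m` it has the irrelevant value `k`.
  have hex : ∀ k, ∃ p, k ≤ p ∧ (p = k ∧ m < k ∨ k ≤ m ∧ Occurs σ w p ∧ p ≤ m ∧
      ∀ j, k ≤ j → j < p → ¬ Occurs σ w j) := by
    intro k
    by_cases hk : k ≤ m
    · have hex1 : ∃ p, k ≤ p ∧ Occurs σ w p := ⟨m, hk, hmo⟩
      obtain ⟨h1, h2⟩ := Nat.find_spec hex1
      exact ⟨Nat.find hex1, h1, Or.inr ⟨hk, h2, Nat.find_min' hex1 ⟨hk, hmo⟩,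
        fun j hj hj' ho => Nat.find_min hex1 hj' ⟨hj, ho⟩⟩⟩
    · exact ⟨k, le_rfl, Or.inl ⟨rfl, by omega⟩⟩
  choose nx hnx1 hnx2 using hex
  have hocc : ∀ k, k ≤ m → Occurs σ w (nx k) := fun k hk =>
    ((hnx2 k).resolve_left fun h => by omega).2.1
  have hnxle : ∀ k p, k ≤ m → k ≤ p → Occurs σ w p → nx k ≤ p := by
    intro k p hk hp ho
    by_contra h
    exact ((hnx2 k).resolve_left fun h => by omega).2.2.2 p hp (by omega) ho
  have hnxm : ∀ k, k ≤ m → nx k ≤ m := fun k hk => hnxle k m hk hk hmo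
  have hstay : ∀ k, k < m → k < nx k → nx (k + 1) = nx k := by
    intro k hk hlt
    refine le_antisymm (hnxle (k + 1) _ hk hlt (hocc k hk.le)) ?_
    exact hnxle k _ hk.le (by have := hnx1 (k + 1); omega) (hocc (k + 1) hk)
  have hstart : nx n = n + r := by
    refine le_antisymm (hnxle n _ (by omega) (by omega) hqo) ?_
    by_contra h
    exact hqno (nx n) (by omega) (by have := hnx1 n; omega) (hocc n (by omega))
  have hlevel : ∀ k, n ≤ k → k ≤ m → nx k ≤ k + r := by
    intro k hk
    induction k, hk using Nat.le_induction with
    | base => exact fun _ => hstart.le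
    | succ k hk ih =>
      intro hkm
      rcases (hnx1 k).eq_or_lt with h | h
      · have hqk : n + r ≤ k := by
          by_contra hlt
          have h1 := hocc k (by omega)
          rw [← h] at h1
          exact hqno k (by omega) (by omega) h1
        obtain ⟨p, hp1, hp2, hp3⟩ := hgap k hqk hkm
        exact (hnxle (k + 1) p hkm hp1 hp3).trans (by omega)
      · rw [hstay k hkm h]
        exact (ih (by omega)).trans (by omega)
  obtain ⟨x₀, -⟩ := hmo
  have hvar : ∀ p, ∃ x, Occurs σ w p → σ p x = w := by
    intro p
    by_cases h : Occurs σ w p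
    · obtain ⟨x, hx⟩ := h
      exact ⟨x, fun _ => hx⟩
    · exact ⟨x₀, fun h' => (h h').elim⟩
  choose var hvar using hvar
  -- The reduction modulo `r + 1` is harmless: `hlevel` bounds `nx k - k` by `r` throughout the
  -- excursion.
  refine ⟨n, by omega, (fun k => (Fin.ofNat (r + 1) (nx k - k), var (nx k)), m),
    ⟨by dsimp only; omega, ⟨var (nx n), ?_, ?_⟩, fun k hk hkm => ?_, ?_⟩⟩
  · rw [hstart]
    refine isStart_remoteFrameOf.2 ?_
    rw [hvar _ hqo]
    exact ⟨fun k hk hk' => hqno k hk' (by omega), htype⟩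
  · refine Prod.ext (Fin.ext ?_) rfl
    dsimp only
    rw [hstart, Fin.val_ofNat, Fin.val_last, Nat.add_sub_cancel_left, Nat.mod_eq_of_lt (by omega)]
  · dsimp only at hkm ⊢
    have h1 := hlevel k hk hkm.le
    have h2 := hlevel (k + 1) (by omega) hkm
    have h3 := hnx1 k
    have h4 := hnx1 (k + 1)
    have e1 : ((Fin.ofNat (r + 1) (nx k - k) : Fin (r + 1)) : ℕ) = nx k - k := by
      rw [Fin.val_ofNat, Nat.mod_eq_of_lt (by omega)]
    have e2 : ((Fin.ofNat (r + 1) (nx (k + 1) - (k + 1)) : Fin (r + 1)) : ℕ) =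
        nx (k + 1) - (k + 1) := by
      rw [Fin.val_ofNat, Nat.mod_eq_of_lt (by omega)]
    rcases h3.eq_or_lt with h | h
    · have hqk : n + r ≤ k := by
        by_contra hlt
        have h5 := hocc k (by omega)
        rw [← h] at h5
        exact hqno k (by omega) (by omega) h5
      obtain ⟨p, hp1, hp2, hp3⟩ := hgap k hqk hkm
      have h5 := hnxle (k + 1) p hkm hp1 hp3
      refine Or.inr ⟨Fin.ext ?_, ⟨nx (k + 1) - k, by omega⟩, ?_, ?_⟩
      · dsimp only
        rw [e1, Fin.val_zero]
        omega
      · dsimp only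
        rw [e2]
        omega
      · change σ (k + (0 : ℕ)) (var (nx k)) = σ (k + (nx (k + 1) - k)) (var (nx (k + 1)))
        rw [Nat.add_sub_cancel' (by omega), hvar _ (hocc (k + 1) hkm), Nat.add_zero, ← h]
        refine hvar k ?_
        have h6 := hocc k (by omega)
        rwa [← h] at h6
    · refine Or.inl ⟨?_, ?_⟩
      · dsimp only
        rw [e1, e2, hstay k hkm h]
        omega
      · dsimp only
        rw [hstay k hkm h]
  · have h1 : nx m = m := le_antisymm (hnxm m le_rfl) (hnx1 m)
    have h2 : (Fin.ofNat (r + 1) (m - m) : Fin (r + 1)) = 0 := by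
      ext
      simp
    have h3 := hocc m le_rfl
    rw [h1] at h3
    dsimp only
    rw [h1, h2, mem_nowSet_remoteFrameOf, xfSet_remoteFrameOf, Fin.val_zero, Nat.add_zero,
      hvar m h3]
    exact hgood

/-- A sequence of tracked cells for `Y` and `z`. -/
theorem exists_tracked_cells [Finite R] (r : ℕ) (σ : ℕ → R → D) (Y : Set R) (z : R) :
    ∃ t : ℕ → Option (Cell R r), t 0 = none ∧
      (∀ n, t n = none → t (n + 1) = none ∨
        ∃ x, IsStart (remoteFrameOf r σ n) Y x ∧ t (n + 1) = some (Fin.last r, x)) ∧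
      (∀ n c, t (n + 1) = some c →
        ((z ∈ nowSet (remoteFrameOf r σ n) c.1 c.2 ∨ xfSet (remoteFrameOf r σ n) c.1 c.2 ≠ Y) ∧
          t (n + 2) = none) ∨
        ∃ d, Follow (remoteFrameOf r σ n) c d ∧ t (n + 2) = some d) ∧
      (z ∈ Y → (¬ ∃ N, ∀ n, N ≤ n → (incPoints (remoteFrameOf r σ n) Y).ncard = 0) →
        (∀ N, ∃ n, N ≤ n ∧ t n = none) ∧ ∀ N, ∃ n, N ≤ n ∧ t n ≠ none) := by
  obtain ⟨t, h1, h2, h3, h4⟩ := exists_track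
    (fun n c => ∃ x, IsStart (remoteFrameOf r σ n) Y x ∧ c = (Fin.last r, x))
    (fun n c => z ∈ nowSet (remoteFrameOf r σ n) c.1 c.2 ∨ xfSet (remoteFrameOf r σ n) c.1 c.2 ≠ Y)
    (fun n c d => Follow (remoteFrameOf r σ n) c d)
  refine ⟨t, h1, fun n hn => (h2 n hn).imp_right ?_, h3, fun hz hinf => h4 fun N => ?_⟩
  · rintro ⟨_, ⟨x, hx, rfl⟩, h⟩
    exact ⟨x, hx, h⟩
  · push Not at hinf
    obtain ⟨n₀, hn₀, hne⟩ := hinf N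
    rw [ncard_incPoints_remoteFrameOf] at hne
    obtain ⟨w, hw, ho⟩ := Set.nonempty_of_ncard_ne_zero hne
    obtain ⟨n, hn, g, hg⟩ := exists_excursion hz hw ho
    exact ⟨n, hn₀.trans hn, g, hg⟩

end Tracking

/-! ### From a realization to an accepting run. -/

section

variable {D : Type*} [LT D] {L R : Type} {l r : ℕ}

theorem incPoints_empty {Y : Set R} (hY : Y.Nonempty) :
    (incPoints (∅ : Set (RemoteConstraint R r)) Y).ncard = 0 := by
  have : incPoints (∅ : Set (RemoteConstraint R r)) Y = ∅ := by
    rw [Set.eq_empty_iff_forall_notMem]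
    rintro C ⟨x, -, -, h⟩
    obtain ⟨z, hz⟩ := hY
    rw [← h] at hz
    exact hz
  rw [this, Set.ncard_empty]

/-- The run waits in the initial part until all counters incremented only finitely often are
permanently zero and idle. It then enters the component testing exactly these; every other counter
is incremented infinitely often, so excursions for it never run out. -/
theorem mem_language_of_remoteRealizable [Finite L] [Finite R] {ρ : ℕ → Frame D L R l r}
    (hsymb : IsSymbolicModel ρ) (hreal : RemoteRealizable ρ) :
    ρ ∈ (realAutomaton D L R l r).language := by
  classical
  obtain ⟨σ, hσ⟩ := hreal
  replace hσ : ∀ n, remoteProj (ρ n).1 = remoteFrameOf r σ n := hσ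
  choose v d hv0 hv1 hd0 hd hvd hvz using fun Y : RCounter R => exists_counter r σ Y.2
  choose t ht0 ht1 ht2 ht3 using fun (Y : RCounter R) (z : R) => exists_tracked_cells r σ Y.1 z
  let Z : Set (RCounter R) :=
    {Y | ∃ N, ∀ n, N ≤ n → (incPoints (remoteFrameOf r σ n) Y.1).ncard = 0}
  obtain ⟨M, hM⟩ : ∃ M, ∀ Y ∈ Z, ∀ n, M ≤ n → v Y n = 0 ∧ d Y n = 0 ∧
      (incPoints (remoteFrameOf r σ n) Y.1).ncard = 0 := by
    choose! m hm using hvz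
    obtain ⟨M, hM⟩ := ((Set.toFinite Z).image m).bddAbove
    exact ⟨M, fun Y hY n hn => hm Y hY n ((hM ⟨Y, hY, rfl⟩).trans hn)⟩
  let q : ℕ → RealState D L R l r := fun n =>
    ⟨Nat.casesOn n none fun n => some (ρ n), if n ≤ M then none else some Z,
      fun z => pending (remoteFrameOf r σ) z n, fun Y z => t Y z n⟩
  have hlast : ∀ n, (q (n + 1)).last = some (ρ n) := fun n => rfl
  have hrem0 : (q 0).rem = ∅ := by
    rw [Set.eq_empty_iff_forall_notMem]
    rintro c ⟨F, h, -⟩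
    cases h
  have hrem1 : ∀ n, (q (n + 1)).rem = remoteFrameOf r σ n := fun n => by
    rw [RealState.rem_eq (hlast n), hσ]
  have hrem : ∀ n, (q n).rem = previous (remoteFrameOf r σ) n := by
    intro n
    cases n with
    | zero => exact hrem0
    | succ n => exact hrem1 n
  have hcomp : ∀ n Z', (q n).comp = some Z' → M < n ∧ Z' = Z := by
    intro n Z' h
    by_cases hn : n ≤ M
    · simp [q, hn] at h
    · simp only [q, if_neg hn, Option.some.injEq] at h
      exact ⟨not_le.1 hn, h.symm⟩
  have hcomp0 : ∀ n, n ≤ M → (q n).comp = none := fun n hn => if_pos hn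
  have hcomp' : ∀ n, M < n → (q n).comp = some Z := fun n hn => if_neg (not_le.2 hn)
  refine ⟨q, fun n Y => v Y n, fun n Y => ((v Y (n + 1) : ℤ) - v Y n), ⟨?_, fun Y => hv0 Y, ?_,
    fun n Y => (add_sub_cancel _ _).symm, ?_⟩, Z, ⟨M + 1, fun n hn => hcomp' n hn⟩, ?_⟩
  · exact ⟨rfl, hcomp0 0 (Nat.zero_le _), fun z => rfl, fun Y z => ht0 Y z⟩
  · intro n
    refine (⟨rfl, ?_, ?_, ⟨fun Y => d Y n, ?_, ?_, ?_⟩, ?_, ?_, ?_, ?_⟩ :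
      RealStep (q n) (ρ n) (fun Y => ((v Y (n + 1) : ℤ) - v Y n)) (q (n + 1)))
    · intro F hF
      cases n with
      | zero => cases hF
      | succ n =>
        obtain rfl : ρ n = F := Option.some.inj hF
        exact hsymb n
    · by_cases hn : n ≤ M
      · exact Or.inl (hcomp0 n hn)
      · exact Or.inr ((hcomp' (n + 1) (by omega)).trans (hcomp' n (by omega)).symm)
    · intro Y
      rw [hσ]
      exact hd Y n
    · intro Y
      cases n with
      | zero => simp [hrem0, incPoints_empty Y.2, hv0, hv1, hd0]
      | succ n =>
        rw [hrem1]
        have := hvd Y n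
        simp only [show n + 2 = n + 1 + 1 from rfl] at this
        dsimp only
        omega
    · intro Z' hZ' Y hY
      obtain ⟨h1, rfl⟩ := hcomp n Z' hZ'
      obtain ⟨n, rfl⟩ := Nat.exists_eq_add_of_le' (show 1 ≤ n by omega)
      rw [hrem1]
      exact ⟨(hM Y hY n (by omega)).2.2, (hM Y hY (n + 1) (by omega)).2.1⟩
    · intro z hz
      rw [hσ]
      exact if_pos hz
    · intro z hz
      rw [hrem]
      exact if_neg hz
    · intro Y z h
      rw [hσ]
      exact ht1 Y z n h
    · intro Y z c hc
      cases n with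
      | zero =>
        rw [show (q 0).track Y z = none from ht0 Y z] at hc
        cases hc
      | succ n =>
        rw [hrem1]
        exact ht2 Y z n c hc
  · intro n Z' _ h Y hY
    obtain ⟨h1, rfl⟩ := hcomp _ _ h
    exact (hM Y hY _ h1.le).1
  · rintro _ (⟨z, rfl⟩ | ⟨Y, hY, z, hz, rfl | rfl⟩) N
    · exact pending_frequently_empty σ z N
    · exact (ht3 Y z hz hY).1 N
    · exact (ht3 Y z hz hY).2 N

theorem realAutomaton_language [Infinite D] [Finite L] [Finite R] :
    (realAutomaton D L R l r).language = {ρ | IsSymbolicModel ρ ∧ RemoteRealizable ρ} :=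
  Set.ext fun _ => ⟨remoteRealizable_of_mem_language,
    fun h => mem_language_of_remoteRealizable h.1 h.2⟩

end

end CLRV

theorem mainTheorem2 {D : Type*} [LinearOrder D] [Infinite D] [DenselyOrdered D] [NoMinOrder D]
    [NoMaxOrder D] {L R : Type} [Finite L] [Finite R] (φ : CLRV.Formula L R) :
    (CLRV.oneStepAutomaton D L R φ.localLength φ.remoteLength).language =
        {ρ | CLRV.IsSymbolicModel ρ} ∧
    (CLRV.symbAutomaton D φ.localLength φ.remoteLength φ).language =
        {ρ | CLRV.SymbSat ρ 0 φ} ∧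
    (CLRV.realAutomaton D L R φ.localLength φ.remoteLength).language =
        {ρ | CLRV.IsSymbolicModel ρ ∧ CLRV.RemoteRealizable ρ} ∧
    (CLRV.formulaAutomaton D φ).language =
        (CLRV.oneStepAutomaton D L R φ.localLength φ.remoteLength).language ∩
        (CLRV.symbAutomaton D φ.localLength φ.remoteLength φ).language ∩
        (CLRV.realAutomaton D L R φ.localLength φ.remoteLength).language ∧
    (φ.Satisfiable D ↔ (CLRV.formulaAutomaton D φ).language.Nonempty) := by
  have h1 := CLRV.oneStepAutomaton_language D L R φ.localLength φ.remoteLength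
  have h2 := CLRV.symbAutomaton_language (D := D) (l := φ.localLength) (r := φ.remoteLength) φ
  have h3 := CLRV.realAutomaton_language (D := D) (L := L) (R := R) (l := φ.localLength)
    (r := φ.remoteLength)
  have h4 : (CLRV.formulaAutomaton D φ).language =
      (CLRV.oneStepAutomaton D L R φ.localLength φ.remoteLength).language ∩
      (CLRV.symbAutomaton D φ.localLength φ.remoteLength φ).language ∩
      (CLRV.realAutomaton D L R φ.localLength φ.remoteLength).language := by
    rw [CLRV.formulaAutomaton, CLRV.SimpleCounterAutomaton.prod_language,
      CLRV.SimpleCounterAutomaton.prod_language]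
    ext ρ
    simp only [Set.mem_inter_iff]
    tauto
  refine ⟨h1, h2, h3, h4, ?_⟩
  rw [h4, h1, h2, h3]
  constructor
  · rintro ⟨σ, hσ⟩
    have hs := CLRV.isSymbolicModel_framesOf (l := φ.localLength) (r := φ.remoteLength)
      (fun n x => σ n (.inl x)) (fun n x => σ n (.inr x))
    refine ⟨_, ⟨hs, ?_⟩, hs, fun n x => σ n (.inr x), fun _ => rfl⟩
    refine (CLRV.symbSat_iff_sat (σ := fun n x => σ n (.inl x)) (τ := fun n x => σ n (.inr x))
      (fun _ => rfl) (fun _ => rfl) φ le_rfl le_rfl 0).2 ?_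
    convert hσ using 2 with n
    ext x
    cases x <;> rfl
  · rintro ⟨ρ, ⟨hs, hsat⟩, -, τ, hτ⟩
    -- Local and remote constraints share no variables, so separate realizations of the two
    -- projections combine into one model.
    obtain ⟨σ, hσ⟩ := CLRV.exists_local_realization (fun n => (ρ n).2.1) (fun n => (hs n).1)
    exact ⟨_, (CLRV.symbSat_iff_sat hσ hτ φ le_rfl le_rfl 0).1 hsat⟩
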